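/- Let $\mathbb K$ be a field, $S=\mathbb K[x_1,\dots,x_n]$ with the standard grading, $\mathfrak m=(x_1,\dots,x_n)$, $n\ge 4$ and $0\le t\le n-4$. Let $(K_\bullet,\partial_\bullet)$ be the Koszul complex of $x_1,\dots,x_n$, with basis $e_J$ of degree $|J|$ ($J\subseteq[n]$), let $E_j=\operatorname{Im}\partial_j\subseteq K_{j-1}$ be the $j$-th syzygy module of $\mathbb K$, let $M(d)_i=M_{d+i}$, and let $e_J^*$ be the basis dual to $e_J$. For disjoint $J,L\subseteq[n]$ put $\sigma(J,L)=(-1)^{\#\{(j,l)\in J\times L\,:\,j>l\}}$. Let $\bar\partial=\partial_{t+1}\oplus\partial_{n-1}:K_{t+1}\oplus K_{n-1}(d)\to E_{t+1}\oplus E_{n-1}(d)$. Let $c,d,a_1,\dots,a_p,b_1,\dots,b_q\in\mathbb Z$, let $I\subseteq S$ be an ideal, and let $$F=\bigoplus_{i=1}^pS(-a_i)\xrightarrow{f}G=\bigoplus_{i=1}^qS(-b_i)\xrightarrow{g}E_{t+1}\oplus E_{n-1}(d)\xrightarrow{\phi}S(c)$$ be graded homomorphisms of degree $0$ such that $g(m_i)\neq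 0$ for every element $m_i$ of the standard basis of $G$. These maps form a *long Bourbaki sequence* if $I$ is a graded ideal, $\operatorname{Im}\phi=I(c)$ and $$0\to F\xrightarrow{f}G\xrightarrow{g}E_{t+1}\oplus E_{n-1}(d)\xrightarrow{\phi}I(c)\to0\qquad(*)$$ is exact. It is of *trivial type* if, over the identity of $E_{t+1}\oplus E_{n-1}(d)$ and of $I(c)$, it is isomorphic as a sequence of graded modules to the direct sum of an exact sequence $0\to F'\to G'\to E_{t+1}\to I(c)\to0$ with graded free modules $F',G'$ of finite rank (possibly zero) and of $0\to K_n(d)\xrightarrow{\partial_n}K_{n-1}(d)\xrightarrow{\partial_{n-1}}E_{n-1}(d)\to0$; otherwise it is of *non-trivial type*. Let $\mathcal A\subseteq K_{t+1}^*$ be the submodule generated by $\sum_{j=1}^{n-t}(-1)^{j+1}\sigma(L\setminus\{i_j\},([n]\setminus L)\cup\{i_j\})\,x_{i_j}e^*_{([n]\setminus L)\cup\{i_j\}}$ for $L=\{i_1<\dots<i_{n-t}\}\subseteq[n]$, and $\mathcal B\subseteq K_{n-1}^*$ the submodule generated by $(-1)^ix_je^*_{[n]\setminus\{i\}}-(-1)^jx_ie^*_{[n]\setminus\{j\}}$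 for $1\le i<j\le n$. An *admissible choice* for the maps above consists of homogeneous elements $\beta_1,\dots,\beta_q\in K_{t+1}\oplus K_{n-1}(d)$ with $\deg\beta_i=b_i$, and of $\varphi=(\varphi_1,\varphi_2)$ with $\varphi_1\in\mathcal A$, $\varphi_2\in\mathcal B$, such that, writing $N=\langle\beta_1,\dots,\beta_q\rangle$ and $\beta:G\to K_{t+1}\oplus K_{n-1}(d)$, $m_i\mapsto\beta_i$: - $\beta_i\notin E_{t+2}\oplus E_n(d)$ for all $i$; - (a) $\varphi:K_{t+1}\oplus K_{n-1}(d)\to S(-n)$ is homogeneous of degree $n+c$ and $\operatorname{Ker}\varphi=N+(E_{t+2}\oplus E_n(d))$; - (b) $p=q-n+2-\binom{n-1}{t}$, $f$ is injective, $\beta\circ f$ maps $F$ onto $N\cap(E_{t+2}\oplus E_n(d))$, and $f$ maps $\operatorname{Ker}(\beta\circ f)$ onto $\operatorname{Ker}\beta$; - $g=\bar\partial\circ\beta$, $\varphi=\phi\circ\bar\partial$, and $I(c)=\varphi(K_{t+1}\oplus K_{n-1}(d))$. **Theorem.** (1) Assume that $t\ge1$, or that $I$ is not of the form $h\,\mathfrak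 m$ with $h\in S$ (which holds, for example, if $\operatorname{codim}I=3$). The maps above form a long Bourbaki sequence $(*)$ of non-trivial type if and only if (i) there is an admissible choice, and (ii) for every admissible choice, the submodule $N=\langle\beta_1,\dots,\beta_q\rangle$ of $K_{t+1}\oplus K_{n-1}(d)$ cannot be decomposed as $N=A\oplus B$ with submodules $0\ne A\subseteq K_{t+1}$ and $0\neq B\subseteq K_{n-1}(d)$. (2) Without the assumption in (1), the same equivalence holds if in (ii) the submodules $A$ and $B$ are allowed to be zero. -/

import Mathlib

open MvPolynomial

noncomputable section

namespace LongBourbaki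

/-- The polynomial ring `S = 𝕜[x_1, …, x_n]`; the variable `x_i` is `X (i - 1)`. -/
abbrev Poly (𝕜 : Type*) [Field 𝕜] (n : ℕ) : Type _ := MvPolynomial (Fin n) 𝕜

/-! ### Gradings

A graded `S`-module is a module with its family of homogeneous components, indexed by `ℤ`. -/

section Gradings

variable {𝕜 : Type*} [Field 𝕜]

/-- The standard grading of `S`, with zero components in negative degrees. -/
def polyGr (𝕜 : Type*) [Field 𝕜] (n : ℕ) (e : ℤ) : Submodule 𝕜 (Poly 𝕜 n) :=
  if 0 ≤ e then homogeneousSubmodule (Fin n) 𝕜 e.toNat else ⊥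

/-- The shift `M(d)`, that is `M(d)_e = M_{d + e}`. -/
def shift {M : Type*} [AddCommGroup M] [Module 𝕜 M] (gr : ℤ → Submodule 𝕜 M) (d : ℤ) :
    ℤ → Submodule 𝕜 M :=
  fun e => gr (d + e)

/-- The grading of a direct sum of two graded modules. -/
def prodGr {M N : Type*} [AddCommGroup M] [Module 𝕜 M] [AddCommGroup N] [Module 𝕜 N]
    (grM : ℤ → Submodule 𝕜 M) (grN : ℤ → Submodule 𝕜 N) : ℤ → Submodule 𝕜 (M × N) :=
  fun e => (grM e).prod (grN e)

/-- The grading of the free module `⨁ i, S(-b_i)`. -/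
def freeGr (𝕜 : Type*) [Field 𝕜] (n : ℕ) {q : ℕ} (b : Fin q → ℤ) (e : ℤ) :
    Submodule 𝕜 (Fin q → Poly 𝕜 n) :=
  Submodule.pi Set.univ fun i => shift (polyGr 𝕜 n) (-b i) e

/-- The map `f` is homogeneous of degree `m`. -/
def IsGradedHom {M N : Type*} [AddCommGroup M] [Module 𝕜 M] [AddCommGroup N] [Module 𝕜 N]
    (m : ℤ) (grM : ℤ → Submodule 𝕜 M) (grN : ℤ → Submodule 𝕜 N) (f : M → N) : Prop :=
  ∀ e : ℤ, ∀ x ∈ grM e, f x ∈ grN (e + m)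

end Gradings

/-! ### The Koszul complex of `x_1, …, x_n` -/

section Koszul

variable (𝕜 : Type*) [Field 𝕜] (n : ℕ)

/-- The `j`-th Koszul module `K_j`: the free module on the `e_J`, `J ⊆ [n]`, `|J| = j`; an element
is its family of coefficients. -/
abbrev Kos (j : ℕ) : Type _ := {J : Finset (Fin n) // J.card = j} → Poly 𝕜 n

/-- The grading of `K_j`, in which `e_J` has degree `|J| = j`. -/
def kosGr (j : ℕ) (e : ℤ) : Submodule 𝕜 (Kos 𝕜 n j) :=
  Submodule.pi Set.univ fun _ => shift (polyGr 𝕜 n) (-(j : ℤ)) e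

/-- The Koszul differential `∂_j : K_j → K_{j-1}`, given on the basis by
`e_J ↦ ∑_{i ∈ J} (-1)^{#{k ∈ J | k < i}} x_i e_{J \ {i}}`; it is written here on coefficients. The
condition in the sum says that `i ∉ I`, and for `j = 0` it never holds, so `∂_0 = 0`. -/
def kosD (j : ℕ) : Kos 𝕜 n j →ₗ[Poly 𝕜 n] Kos 𝕜 n (j - 1) :=
  LinearMap.pi fun I => ∑ i : Fin n,
    if h : (insert i I.1).card = j then
      ((-1) ^ (I.1.filter (· < i)).card * X i : Poly 𝕜 n) •
        (LinearMap.proj (⟨insert i I.1, h⟩ : {J : Finset (Fin n) // J.card = j}) :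
          Kos 𝕜 n j →ₗ[Poly 𝕜 n] Poly 𝕜 n)
    else 0

/-- The `j`-th syzygy module `E_j = Im ∂_j ⊆ K_{j-1}` of the residue field (for `j ≥ 1`). -/
def Syz (j : ℕ) : Submodule (Poly 𝕜 n) (Kos 𝕜 n (j - 1)) := LinearMap.range (kosD 𝕜 n j)

/-- The grading of `E_j` as a graded submodule of `K_{j-1}`. -/
def syzGr (j : ℕ) (e : ℤ) : Submodule 𝕜 (Syz 𝕜 n j) :=
  (kosGr 𝕜 n (j - 1) e).comap ((Syz 𝕜 n j).subtype.restrictScalars 𝕜)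

/-- The module `K_{t+1} ⊕ K_{n-1}` (shifts only affect the grading). -/
abbrev KK (t : ℕ) : Type _ := Kos 𝕜 n (t + 1) × Kos 𝕜 n (n - 1)

/-- The grading of `K_{t+1} ⊕ K_{n-1}(d)`. -/
def kkGr (t : ℕ) (d : ℤ) : ℤ → Submodule 𝕜 (KK 𝕜 n t) :=
  prodGr (kosGr 𝕜 n (t + 1)) (shift (kosGr 𝕜 n (n - 1)) d)

/-- The module `E_{t+1} ⊕ E_{n-1}`. -/
abbrev EE (t : ℕ) : Type _ := Syz 𝕜 n (t + 1) × Syz 𝕜 n (n - 1)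

/-- The grading of `E_{t+1} ⊕ E_{n-1}(d)`. -/
def eeGr (t : ℕ) (d : ℤ) : ℤ → Submodule 𝕜 (EE 𝕜 n t) :=
  prodGr (syzGr 𝕜 n (t + 1)) (shift (syzGr 𝕜 n (n - 1)) d)

/-- The surjection `∂_{t+1} ⊕ ∂_{n-1} : K_{t+1} ⊕ K_{n-1} → E_{t+1} ⊕ E_{n-1}`. -/
def dBar (t : ℕ) : KK 𝕜 n t →ₗ[Poly 𝕜 n] EE 𝕜 n t :=
  (kosD 𝕜 n (t + 1)).rangeRestrict.prodMap (kosD 𝕜 n (n - 1)).rangeRestrict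

/-- The submodule `E_{t+2} ⊕ E_n` of `K_{t+1} ⊕ K_{n-1}`. -/
def syzSub (t : ℕ) : Submodule (Poly 𝕜 n) (KK 𝕜 n t) :=
  Submodule.prod (Syz 𝕜 n (t + 2)) (Syz 𝕜 n n)

/-- The dual basis element `e_J^*` of `K_j^*` for `|J| = j` (and `0` if `|J| ≠ j`). -/
def dualE (j : ℕ) (J : Finset (Fin n)) : Kos 𝕜 n j →ₗ[Poly 𝕜 n] Poly 𝕜 n :=
  if h : J.card = j then LinearMap.proj ⟨J, h⟩ else 0

variable {n} in
/-- The sign `σ(J, L) = (-1)^{#{(j, l) ∈ J × L | j > l}}`. -/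
def sigma (J L : Finset (Fin n)) : Poly 𝕜 n :=
  (-1) ^ ((J ×ˢ L).filter fun x => x.2 < x.1).card

/-- The submodule `𝒜` of `K_{t+1}^*` generated by the elements
`∑_j (-1)^{j+1} σ(L \ {i_j}, ([n] \ L) ∪ {i_j}) x_{i_j} e^*_{([n] \ L) ∪ {i_j}}` with
`L = {i_1 < ⋯ < i_{n-t}} ⊆ [n]`. If `i = i_j`, then `j - 1 = #{l ∈ L | l < i}`. -/
def calA (t : ℕ) : Submodule (Poly 𝕜 n) (Kos 𝕜 n (t + 1) →ₗ[Poly 𝕜 n] Poly 𝕜 n) :=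
  Submodule.span (Poly 𝕜 n)
    {a | ∃ L : Finset (Fin n), L.card = n - t ∧
      a = ∑ i ∈ L, ((-1) ^ (L.filter (· < i)).card * sigma 𝕜 (L.erase i) (insert i Lᶜ) * X i :
        Poly 𝕜 n) • dualE 𝕜 n (t + 1) (insert i Lᶜ)}

/-- The submodule `ℬ` of `K_{n-1}^*` generated by the elements
`(-1)^i x_j e^*_{[n] \ {i}} - (-1)^j x_i e^*_{[n] \ {j}}`, `1 ≤ i < j ≤ n`. -/
def calB : Submodule (Poly 𝕜 n) (Kos 𝕜 n (n - 1) →ₗ[Poly 𝕜 n] Poly 𝕜 n) :=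
  Submodule.span (Poly 𝕜 n)
    {b | ∃ i j : Fin n, i < j ∧
      b = ((-1) ^ ((i : ℕ) + 1) * X j : Poly 𝕜 n) • dualE 𝕜 n (n - 1) (Finset.univ.erase i) -
        ((-1) ^ ((j : ℕ) + 1) * X i : Poly 𝕜 n) • dualE 𝕜 n (n - 1) (Finset.univ.erase j)}

end Koszul

/-! ### Long Bourbaki sequences with approximation module `E_{t+1} ⊕ E_{n-1}(d)` -/

section Sequences

variable {𝕜 : Type*} [Field 𝕜] {n p q : ℕ}

/-- The sequence
`0 → ⨁ S(-a_i) --f--> ⨁ S(-b_i) --g--> E_{t+1} ⊕ E_{n-1}(d) --φ--> I(c) → 0`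
is an exact sequence of graded modules, where `I ⊆ S` is a graded ideal. -/
structure IsLongBourbaki (t : ℕ) (c d : ℤ) (a : Fin p → ℤ) (b : Fin q → ℤ)
    (f : (Fin p → Poly 𝕜 n) →ₗ[Poly 𝕜 n] (Fin q → Poly 𝕜 n))
    (g : (Fin q → Poly 𝕜 n) →ₗ[Poly 𝕜 n] EE 𝕜 n t)
    (φ : EE 𝕜 n t →ₗ[Poly 𝕜 n] Poly 𝕜 n) (I : Ideal (Poly 𝕜 n)) : Prop where
  graded_f : IsGradedHom 0 (freeGr 𝕜 n a) (freeGr 𝕜 n b) f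
  graded_g : IsGradedHom 0 (freeGr 𝕜 n b) (eeGr 𝕜 n t d) g
  graded_phi : IsGradedHom 0 (eeGr 𝕜 n t d) (shift (polyGr 𝕜 n) c) φ
  homogeneous : ∀ x ∈ I, ∀ k : ℕ, homogeneousComponent k x ∈ I
  injective : Function.Injective f
  exact_g : Function.Exact f g
  exact_phi : Function.Exact g φ
  range_phi : LinearMap.range φ = I

/-- The sequence above is of trivial type: over the identity of `E_{t+1} ⊕ E_{n-1}(d)` and of
`I(c)`, it is isomorphic to the direct sum of a long Bourbaki sequence
`0 → F' --f'--> G' --g'--> E_{t+1} --φ'--> I(c) → 0` with graded free modules `F' = ⨁ S(-a'_i)`,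
`G' = ⨁ S(-b'_i)` and of the exact sequence `0 → K_n(d) → K_{n-1}(d) → E_{n-1}(d) → 0`. -/
def IsTrivialType (t : ℕ) (c d : ℤ) (a : Fin p → ℤ) (b : Fin q → ℤ)
    (f : (Fin p → Poly 𝕜 n) →ₗ[Poly 𝕜 n] (Fin q → Poly 𝕜 n))
    (g : (Fin q → Poly 𝕜 n) →ₗ[Poly 𝕜 n] EE 𝕜 n t)
    (φ : EE 𝕜 n t →ₗ[Poly 𝕜 n] Poly 𝕜 n) (I : Ideal (Poly 𝕜 n)) : Prop :=
  ∃ (p' q' : ℕ) (a' : Fin p' → ℤ) (b' : Fin q' → ℤ)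
    (f' : (Fin p' → Poly 𝕜 n) →ₗ[Poly 𝕜 n] (Fin q' → Poly 𝕜 n))
    (g' : (Fin q' → Poly 𝕜 n) →ₗ[Poly 𝕜 n] Syz 𝕜 n (t + 1))
    (φ' : Syz 𝕜 n (t + 1) →ₗ[Poly 𝕜 n] Poly 𝕜 n)
    (u : (Fin p → Poly 𝕜 n) ≃ₗ[Poly 𝕜 n] (Fin p' → Poly 𝕜 n) × Kos 𝕜 n n)
    (v : (Fin q → Poly 𝕜 n) ≃ₗ[Poly 𝕜 n] (Fin q' → Poly 𝕜 n) × Kos 𝕜 n (n - 1)),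
    IsGradedHom 0 (freeGr 𝕜 n a') (freeGr 𝕜 n b') f' ∧
    IsGradedHom 0 (freeGr 𝕜 n b') (syzGr 𝕜 n (t + 1)) g' ∧
    IsGradedHom 0 (syzGr 𝕜 n (t + 1)) (shift (polyGr 𝕜 n) c) φ' ∧
    Function.Injective f' ∧ Function.Exact f' g' ∧ Function.Exact g' φ' ∧
    LinearMap.range φ' = I ∧
    IsGradedHom 0 (freeGr 𝕜 n a) (prodGr (freeGr 𝕜 n a') (shift (kosGr 𝕜 n n) d)) u ∧
    IsGradedHom 0 (freeGr 𝕜 n b) (prodGr (freeGr 𝕜 n b') (shift (kosGr 𝕜 n (n - 1)) d)) v ∧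
    v.toLinearMap ∘ₗ f = (f'.prodMap (kosD 𝕜 n n)) ∘ₗ u.toLinearMap ∧
    g = (g'.prodMap (kosD 𝕜 n (n - 1)).rangeRestrict) ∘ₗ v.toLinearMap ∧
    φ = φ' ∘ₗ LinearMap.fst (Poly 𝕜 n) (Syz 𝕜 n (t + 1)) (Syz 𝕜 n (n - 1))

/-- The long Bourbaki sequence is of non-trivial type. -/
def IsNontrivialType (t : ℕ) (c d : ℤ) (a : Fin p → ℤ) (b : Fin q → ℤ)
    (f : (Fin p → Poly 𝕜 n) →ₗ[Poly 𝕜 n] (Fin q → Poly 𝕜 n))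
    (g : (Fin q → Poly 𝕜 n) →ₗ[Poly 𝕜 n] EE 𝕜 n t)
    (φ : EE 𝕜 n t →ₗ[Poly 𝕜 n] Poly 𝕜 n) (I : Ideal (Poly 𝕜 n)) : Prop :=
  IsLongBourbaki t c d a b f g φ I ∧ ¬ IsTrivialType t c d a b f g φ I

/-- The submodule `N = ⟨β_1, …, β_q⟩` of `K_{t+1} ⊕ K_{n-1}(d)`. -/
def spanBeta {t : ℕ} (β : Fin q → KK 𝕜 n t) : Submodule (Poly 𝕜 n) (KK 𝕜 n t) :=
  Submodule.span (Poly 𝕜 n) (Set.range β)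

/-- The map `β : ⨁ S(-b_i) → K_{t+1} ⊕ K_{n-1}(d)` sending the `i`-th basis element to `β_i`. -/
def betaMap {t : ℕ} (β : Fin q → KK 𝕜 n t) : (Fin q → Poly 𝕜 n) →ₗ[Poly 𝕜 n] KK 𝕜 n t :=
  Fintype.linearCombination (Poly 𝕜 n) β

/-- The conditions on homogeneous elements `β_1, …, β_q` of `K_{t+1} ⊕ K_{n-1}(d)`, on
`ψ = (ψ₁, ψ₂) : K_{t+1} ⊕ K_{n-1}(d) → S(-n)`, and on the map `f` in the commutative diagram with
exact rows and columns
```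
  0 → Ker Res(β)             →  Ker β            → 0
        ↓                        ↓
  0 → ⨁ S(-a_i)       --f-->  ⨁ S(-b_i)
        ↓ Res(β) = β ∘ f         ↓ β
  0 → N ∩ (E_{t+2} ⊕ E_n(d)) →  N = ⟨β_1, …, β_q⟩
        ↓                        ↓
        0                        0
``` -/
structure IsConstructionDatum (t : ℕ) (c d : ℤ) (a : Fin p → ℤ) (b : Fin q → ℤ)
    (f : (Fin p → Poly 𝕜 n) →ₗ[Poly 𝕜 n] (Fin q → Poly 𝕜 n))
    (β : Fin q → KK 𝕜 n t)
    (ψ₁ : Kos 𝕜 n (t + 1) →ₗ[Poly 𝕜 n] Poly 𝕜 n)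
    (ψ₂ : Kos 𝕜 n (n - 1) →ₗ[Poly 𝕜 n] Poly 𝕜 n) : Prop where
  /-- `β_i` is homogeneous of degree `b_i`, that is, the map `β` is graded. -/
  beta_mem : ∀ i, β i ∈ kkGr 𝕜 n t d (b i)
  beta_notMem : ∀ i, β i ∉ syzSub 𝕜 n t
  mem_calA : ψ₁ ∈ calA 𝕜 n t
  mem_calB : ψ₂ ∈ calB 𝕜 n
  degree_psi : IsGradedHom (n + c) (kkGr 𝕜 n t d) (shift (polyGr 𝕜 n) (-n)) (ψ₁.coprod ψ₂)
  ker_psi : LinearMap.ker (ψ₁.coprod ψ₂) = spanBeta β ⊔ syzSub 𝕜 n t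
  rank_eq : (p : ℤ) = q - n + 2 - (n - 1).choose t
  graded_f : IsGradedHom 0 (freeGr 𝕜 n a) (freeGr 𝕜 n b) f
  injective_f : Function.Injective f
  range_res : LinearMap.range (betaMap β ∘ₗ f) = spanBeta β ⊓ syzSub 𝕜 n t
  ker_res : (LinearMap.ker (betaMap β ∘ₗ f)).map f = LinearMap.ker (betaMap β)

/-- The data `β_1, …, β_q`, `ψ = (ψ₁, ψ₂)` satisfy the conditions above and belong to the sequence
given by `f`, `g`, `φ`, `I`: the map `β` lifts `g` along `∂_{t+1} ⊕ ∂_{n-1}`, the map `ψ` is the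
composite of `φ` with `∂_{t+1} ⊕ ∂_{n-1}`, and `I` is the image of `ψ`. -/
structure IsConstructionOf (t : ℕ) (c d : ℤ) (a : Fin p → ℤ) (b : Fin q → ℤ)
    (f : (Fin p → Poly 𝕜 n) →ₗ[Poly 𝕜 n] (Fin q → Poly 𝕜 n))
    (g : (Fin q → Poly 𝕜 n) →ₗ[Poly 𝕜 n] EE 𝕜 n t)
    (φ : EE 𝕜 n t →ₗ[Poly 𝕜 n] Poly 𝕜 n) (I : Ideal (Poly 𝕜 n))
    (β : Fin q → KK 𝕜 n t)
    (ψ₁ : Kos 𝕜 n (t + 1) →ₗ[Poly 𝕜 n] Poly 𝕜 n)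
    (ψ₂ : Kos 𝕜 n (n - 1) →ₗ[Poly 𝕜 n] Poly 𝕜 n) : Prop where
  datum : IsConstructionDatum t c d a b f β ψ₁ ψ₂
  lifts : dBar 𝕜 n t ∘ₗ betaMap β = g
  comp_phi : φ ∘ₗ dBar 𝕜 n t = ψ₁.coprod ψ₂
  range_psi : LinearMap.range (ψ₁.coprod ψ₂) = I

end Sequences

end LongBourbaki

end

/-! Exactness of the Koszul complex (`ker_kosD`) identifies the kernel of the surjection `dBar` with
`E_{t+2} ⊕ E_n` (`mem_syzSub_iff`). Lifting `g` to `β` along `dBar` and putting `ψ = φ ∘ dBar`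
therefore turns exactness of the sequence at each place into a condition on `β`, `ψ` and `f`.
Exactness of the dual complex places the components of `ψ` in `𝒜` and `ℬ` (`mem_calA`, `mem_calB`),
and a count of ranks determines `p` (`rank_formula`). So admissible choices exist exactly when the
maps form a long Bourbaki sequence (`IsLongBourbaki.isConstructionOf`,
`IsConstructionOf.isLongBourbaki`).

It remains to match trivial type with decomposability of `N`. For a sequence of trivial type, lift
`g'` on `G'` and use the identity on `K_{n-1}(d)`: then `N = A ⊕ K_{n-1}`. If `A = 0`, then `g' = 0`
and `φ'` embeds `E_{t+1}` in `S`; comparing ranks gives `t = 0`, and then `I = h𝔪`. This is the case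
excluded in the first equivalence (`IsTrivialType.exists_decomposition`).

Conversely, let `N = A ⊕ B`. Then `Ker ψ` is a product of submodules of the two summands. Since `ψ`
takes values in a domain, one component of `ψ` must vanish, and it is `ψ₂`: otherwise `E_{t+1}`
would be a summand of `Im g`, hence of projective dimension at most one, making `E_{t+2}` projective
(`exists_phi_inl_ne_zero`, `not_projective_syz`). Now `B + E_n = K_{n-1}` with `E_n ⊆ 𝔪 K_{n-1}`,
and a graded Nakayama argument gives a graded section of `β` over `K_{n-1}(d)`
(`IsConstructionOf.exists_section`). The section splits `K_{n-1}(d)` off `G`; injectivity of `f` and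
of `∂_n` splits `K_n(d)` off `F`; both complements are graded free (`exists_graded_splitting`), and
the sequence is of trivial type. -/

namespace LongBourbaki

/-! ### Exactness of the Koszul complex and of its dual -/

/-! ### Koszul complexes with abstract signs, on families indexed by all subsets -/

section SignedKoszul

variable {𝕜 : Type*} [Field 𝕜] {n : ℕ}

/-- Division of a polynomial by the variable `x_i`, discarding the remainder. -/
noncomputable def divX (i : Fin n) : Poly 𝕜 n →ₗ[𝕜] Poly 𝕜 n where
  toFun f := f.divMonomial (Finsupp.single i 1)
  map_add' f g := add_divMonomial f g _
  map_smul' r f := by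
    ext m
    simp [coeff_divMonomial]

theorem divX_X_mul (i : Fin n) (f : Poly 𝕜 n) : divX i (X i * f) = f :=
  X_mul_divMonomial i f

/-- Whether `x_k` divides a monomial is not affected by a factor `x_i`. This commutation is what
lets division by `x_i` serve as a contracting homotopy. -/
theorem divX_X_mul_of_ne {i k : Fin n} (h : k ≠ i) (f : Poly 𝕜 n) :
    divX i (X k * f) = X k * divX i f := by
  ext m
  change coeff m ((X k * f).divMonomial _) = coeff m (X k * f.divMonomial _)
  rw [coeff_divMonomial, coeff_X_mul', coeff_X_mul', coeff_divMonomial]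
  have h1 : k ∈ (Finsupp.single i 1 + m).support ↔ k ∈ m.support := by
    simp [h.symm]
  simp only [h1]
  split_ifs with hk
  · congr 1
    refine (add_tsub_assoc_of_le ?_ _)
    rw [Finsupp.single_le_iff]
    exact Nat.one_le_iff_ne_zero.2 (Finsupp.mem_support_iff.1 hk)
  · rfl

/-- The differential `z ↦ (I ↦ ∑_{i ∉ I} ε(i, I) x_i z(I ∪ {i}))` on families indexed by all
subsets of `[n]`. -/
noncomputable def signD (ε : Fin n → Finset (Fin n) → 𝕜) (z : Finset (Fin n) → Poly 𝕜 n)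
    (I : Finset (Fin n)) : Poly 𝕜 n :=
  ∑ i, if i ∈ I then 0 else ε i I • (X i * z (insert i I))

/-- The signs `ε` are invertible and make the summands of `signD` anticommute. -/
structure IsKoszulSign (ε : Fin n → Finset (Fin n) → 𝕜) : Prop where
  mul_self : ∀ i I, ε i I * ε i I = 1
  anticomm : ∀ i k I, i ∉ I → k ∉ I → i ≠ k →
    ε i I * ε k (insert i I) = -(ε k I * ε i (insert k I))

variable {ε : Fin n → Finset (Fin n) → 𝕜}

theorem signD_sub (z w : Finset (Fin n) → Poly 𝕜 n) :
    signD ε (z - w) = signD ε z - signD ε w := by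
  ext1 I
  simp only [signD, Pi.sub_apply, ← Finset.sum_sub_distrib]
  refine Finset.sum_congr rfl fun i _ => ?_
  split_ifs
  · simp
  · rw [mul_sub, smul_sub]

theorem signD_add (z w : Finset (Fin n) → Poly 𝕜 n) :
    signD ε (z + w) = signD ε z + signD ε w := by
  ext1 I
  simp only [signD, Pi.add_apply, ← Finset.sum_add_distrib]
  refine Finset.sum_congr rfl fun i _ => ?_
  split_ifs
  · simp
  · rw [mul_add, smul_add]

/-- In the double sum the terms of `(i, k)` and `(k, i)` cancel by anticommutation. Only the axioms
on `ε` enter, so the Koszul complex and its dual are treated at once. -/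
theorem signD_signD (hε : IsKoszulSign ε) (z : Finset (Fin n) → Poly 𝕜 n) :
    signD ε (signD ε z) = 0 := by
  ext1 I
  have h : signD ε (signD ε z) I = ∑ x : Fin n × Fin n,
      if x.1 ∈ I ∨ x.2 ∈ I ∨ x.1 = x.2 then 0 else
        (ε x.1 I * ε x.2 (insert x.1 I)) • (X x.1 * X x.2 * z (insert x.2 (insert x.1 I))) := by
    rw [Fintype.sum_prod_type]
    refine Finset.sum_congr rfl fun i _ => ?_
    by_cases hi : i ∈ I
    · simp [hi]
    rw [if_neg hi, signD, Finset.mul_sum, Finset.smul_sum]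
    refine Finset.sum_congr rfl fun k _ => ?_
    by_cases hk : k ∈ I
    · simp [hk]
    by_cases hik : i = k
    · simp [hik]
    · rw [if_neg (by simp [hk, Ne.symm hik]), if_neg (by simp [hi, hk, hik]), mul_smul_comm,
        smul_smul, mul_assoc]
  rw [h]
  refine Finset.sum_involution (fun x _ => (x.2, x.1)) ?_ ?_ (fun _ _ => Finset.mem_univ _)
    (fun _ _ => rfl)
  · rintro ⟨i, k⟩ -
    by_cases hc : i ∈ I ∨ k ∈ I ∨ i = k
    · have hc' : k ∈ I ∨ i ∈ I ∨ k = i := by tauto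
      simp only [if_pos hc, if_pos hc', add_zero]
    · have hc' : ¬ (k ∈ I ∨ i ∈ I ∨ k = i) := by tauto
      simp only [if_neg hc, if_neg hc']
      push Not at hc
      rw [hε.anticomm i k I hc.1 hc.2.1 hc.2.2, Finset.insert_comm, mul_comm (X i), neg_smul,
        neg_add_cancel]
  · rintro ⟨i, k⟩ - hne heq
    apply hne
    simp only [Prod.mk.injEq] at heq
    simp [heq.2]

/-- The contracting homotopy in the direction of `x_i`. -/
noncomputable def signH (ε : Fin n → Finset (Fin n) → 𝕜) (i : Fin n)
    (z : Finset (Fin n) → Poly 𝕜 n) (J : Finset (Fin n)) : Poly 𝕜 n :=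
  if i ∈ J then ε i (J.erase i) • divX i (z (J.erase i)) else 0

/-- Only the summand adjoining `i` survives. In particular the homotopy contributes nothing at a set
where `z` already vanishes. -/
theorem signD_signH_of_notMem (hε : IsKoszulSign ε) (z : Finset (Fin n) → Poly 𝕜 n) {i : Fin n}
    {I : Finset (Fin n)} (hi : i ∉ I) : signD ε (signH ε i z) I = X i * divX i (z I) := by
  rw [signD, Finset.sum_eq_single i]
  · rw [if_neg hi, signH, if_pos (Finset.mem_insert_self _ _), Finset.erase_insert hi,
      mul_smul_comm, smul_smul, hε.mul_self, one_smul]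
  · intro k _ hk
    have hik : i ∉ insert k I := by simp [hk.symm, hi]
    simp [signH, hik]
  · simp

/-- The cycle relation at `I \ {i}` expresses `x_i z(I)` through the other summands; dividing it by
`x_i` recovers `z(I)`. -/
theorem signD_signH_of_mem (hε : IsKoszulSign ε) {z : Finset (Fin n) → Poly 𝕜 n}
    (hz : signD ε z = 0) {i : Fin n} {I : Finset (Fin n)} (hi : i ∈ I) :
    signD ε (signH ε i z) I = z I := by
  obtain ⟨J, hJ, rfl⟩ : ∃ J, i ∉ J ∧ insert i J = I :=
    ⟨I.erase i, Finset.notMem_erase _ _, Finset.insert_erase hi⟩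
  have h1 := congrFun hz J
  rw [signD, ← Finset.add_sum_erase _ _ (Finset.mem_univ i), if_neg hJ] at h1
  have h2 : signD ε (signH ε i z) (insert i J) = -(ε i J • divX i
      (∑ k ∈ Finset.univ.erase i, if k ∈ J then 0 else ε k J • (X k * z (insert k J)))) := by
    rw [signD, ← Finset.add_sum_erase _ _ (Finset.mem_univ i),
      if_pos (Finset.mem_insert_self _ _), zero_add, map_sum, Finset.smul_sum,
      ← Finset.sum_neg_distrib]
    refine Finset.sum_congr rfl fun k hk => ?_
    have hki : k ≠ i := Finset.ne_of_mem_erase hk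
    by_cases hkJ : k ∈ J
    · simp [hkJ]
    rw [if_neg (by simp [hki, hkJ]), if_neg hkJ, map_smul, divX_X_mul_of_ne hki, signH,
      if_pos (by simp), Finset.insert_comm k i, Finset.erase_insert (by simp [hki.symm, hJ]),
      mul_smul_comm, smul_smul, smul_smul, ← neg_smul]
    congr 1
    have h3 := hε.anticomm i k J hJ hkJ hki.symm
    calc _ = (ε i J * ε i J) * (ε k (insert i J) * ε i (insert k J)) := by
          rw [hε.mul_self, one_mul]
      _ = ε i J * (ε i J * ε k (insert i J)) * ε i (insert k J) := by ring
      _ = -(ε i J * ε k J) * (ε i (insert k J) * ε i (insert k J)) := by rw [h3]; ring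
      _ = _ := by rw [hε.mul_self, mul_one]
  rw [h2, ← neg_eq_of_add_eq_zero_right h1, map_neg, map_smul, divX_X_mul, smul_neg, neg_neg,
    smul_smul, hε.mul_self, one_smul]

/-- The signed Koszul complex is exact except in degree zero. -/
theorem exists_signD_eq (hε : IsKoszulSign ε) {z : Finset (Fin n) → Poly 𝕜 n}
    (hz : signD ε z = 0) : ∃ w, ∀ I : Finset (Fin n), I.Nonempty → signD ε w I = z I := by
  -- Make the remainder vanish on all sets meeting `V`, one direction at a time. Correcting in
  -- direction `i` clears the sets containing `i`, and on the others it preserves the zeros already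
  -- obtained.
  have key : ∀ V : Finset (Fin n), ∃ w, ∀ i ∈ V, ∀ I : Finset (Fin n), i ∈ I →
      (z - signD ε w) I = 0 := by
    intro V
    induction V using Finset.induction_on with
    | empty => exact ⟨0, by simp⟩
    | insert i V hi ih =>
      obtain ⟨w, hw⟩ := ih
      set y := z - signD ε w with hy
      have hy0 : signD ε y = 0 := by rw [hy, signD_sub, hz, signD_signD hε, sub_zero]
      refine ⟨w + signH ε i y, ?_⟩
      have h1 : z - signD ε (w + signH ε i y) = y - signD ε (signH ε i y) := by
        rw [signD_add, hy]; abel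
      rw [h1]
      intro k hk I hkI
      by_cases hiI : i ∈ I
      · rw [Pi.sub_apply, signD_signH_of_mem hε hy0 hiI, sub_self]
      · have hkV : k ∈ V := by
          rcases Finset.mem_insert.1 hk with rfl | h
          · exact absurd hkI hiI
          · exact h
        rw [Pi.sub_apply, signD_signH_of_notMem hε y hiI, hw k hkV I hkI]
        simp
  obtain ⟨w, hw⟩ := key Finset.univ
  refine ⟨w, fun I hI => ?_⟩
  obtain ⟨i, hi⟩ := hI
  exact (sub_eq_zero.1 (hw i (Finset.mem_univ _) I hi)).symm

/-- The signs of the Koszul differential. -/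
noncomputable def kosSign (𝕜 : Type*) [Field 𝕜] (i : Fin n) (I : Finset (Fin n)) : 𝕜 :=
  (-1) ^ (I.filter (· < i)).card

/-- The signs of the dual Koszul differential, written on complements. -/
noncomputable def dualSign (𝕜 : Type*) [Field 𝕜] (i : Fin n) (I : Finset (Fin n)) : 𝕜 :=
  (-1) ^ (Iᶜ.filter (· < i)).card

theorem neg_one_pow_mul_self (m : ℕ) : ((-1 : 𝕜) ^ m) * (-1) ^ m = 1 := by
  rw [← mul_pow]; simp

theorem kosSign_insert {i k : Fin n} {I : Finset (Fin n)} (hi : i ∉ I) :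
    kosSign 𝕜 k (insert i I) = if i < k then -kosSign 𝕜 k I else kosSign 𝕜 k I := by
  unfold kosSign
  rw [Finset.filter_insert]
  split_ifs with h
  · rw [Finset.card_insert_of_notMem (by simp [hi]), pow_succ]; ring
  · rfl

theorem dualSign_insert {i k : Fin n} {I : Finset (Fin n)} (hi : i ∉ I) :
    dualSign 𝕜 k (insert i I) = if i < k then -dualSign 𝕜 k I else dualSign 𝕜 k I := by
  unfold dualSign
  have h1 : Iᶜ = insert i (insert i I)ᶜ := by
    ext j; by_cases h : j = i <;> simp [h, hi]
  rw [h1, Finset.filter_insert]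
  split_ifs with h
  · rw [Finset.card_insert_of_notMem (by simp), pow_succ]; ring
  · rfl

theorem isKoszulSign_kosSign : IsKoszulSign (kosSign 𝕜 (n := n)) where
  mul_self _ _ := neg_one_pow_mul_self _
  anticomm i k I hi hk hik := by
    rw [kosSign_insert hi, kosSign_insert hk]
    rcases lt_or_gt_of_ne hik with h | h
    · rw [if_pos h, if_neg h.le.not_gt]; ring
    · rw [if_pos h, if_neg h.le.not_gt]; ring

theorem isKoszulSign_dualSign : IsKoszulSign (dualSign 𝕜 (n := n)) where
  mul_self _ _ := neg_one_pow_mul_self _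
  anticomm i k I hi hk hik := by
    rw [dualSign_insert hi, dualSign_insert hk]
    rcases lt_or_gt_of_ne hik with h | h
    · rw [if_pos h, if_neg h.le.not_gt]; ring
    · rw [if_pos h, if_neg h.le.not_gt]; ring

end SignedKoszul

/-! ### Exactness of the Koszul complex and of its dual, degree by degree -/

section Koszul

variable {𝕜 : Type*} [Field 𝕜] {n : ℕ}

theorem kosSign_smul (i : Fin n) (I : Finset (Fin n)) (f : Poly 𝕜 n) :
    kosSign 𝕜 i I • f = (-1) ^ (I.filter (· < i)).card * f := by
  rw [MvPolynomial.smul_eq_C_mul, kosSign]; simp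

theorem kosD_apply (j : ℕ) (x : Kos 𝕜 n j) (I : {J : Finset (Fin n) // J.card = j - 1}) :
    kosD 𝕜 n j x I = ∑ i, if h : (insert i I.1).card = j then
      (-1) ^ (I.1.filter (· < i)).card * X i * x ⟨insert i I.1, h⟩ else 0 := by
  rw [kosD, LinearMap.pi_apply, LinearMap.sum_apply]
  refine Finset.sum_congr rfl fun i _ => ?_
  split_ifs <;> simp

theorem card_insert_eq_iff {j : ℕ} (hj : 1 ≤ j) {i : Fin n} {I : Finset (Fin n)}
    (hI : I.card = j - 1) : (insert i I).card = j ↔ i ∉ I := by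
  by_cases h : i ∈ I
  · simp only [h, not_true_eq_false, iff_false, Finset.insert_eq_of_mem h]; omega
  · simp only [h, not_false_eq_true, iff_true, Finset.card_insert_of_notMem h]; omega

/-- For `|I| = j - 1` the cardinality test in `kosD` just says `i ∉ I`. This carries results on
families over all subsets back to the modules `K_j`. -/
theorem kosD_restrict {j : ℕ} (hj : 1 ≤ j) (w : Finset (Fin n) → Poly 𝕜 n)
    (I : {J : Finset (Fin n) // J.card = j - 1}) :
    kosD 𝕜 n j (fun J => w J.1) I = signD (kosSign 𝕜) w I.1 := by
  rw [kosD_apply, signD]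
  refine Finset.sum_congr rfl fun i _ => ?_
  by_cases h : i ∈ I.1
  · rw [if_pos h, dif_neg (by rw [card_insert_eq_iff hj I.2]; simpa using h)]
  · rw [if_neg h, dif_pos ((card_insert_eq_iff hj I.2).2 h), kosSign_smul, mul_assoc]

/-- Extension by zero of a family indexed by the subsets of cardinality `j`. -/
noncomputable def extZero {j : ℕ} (x : Kos 𝕜 n j) (J : Finset (Fin n)) : Poly 𝕜 n :=
  if h : J.card = j then x ⟨J, h⟩ else 0

theorem extZero_restrict {j : ℕ} (x : Kos 𝕜 n j) :
    (fun J : {J : Finset (Fin n) // J.card = j} => extZero x J.1) = x := by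
  ext1 J
  simp [extZero, J.2]

theorem signD_extZero_of_card_ne {j : ℕ} (ε : Fin n → Finset (Fin n) → 𝕜) (x : Kos 𝕜 n j)
    {I : Finset (Fin n)} (hI : I.card + 1 ≠ j) : signD ε (extZero x) I = 0 := by
  refine Finset.sum_eq_zero fun i _ => ?_
  split_ifs with h
  · rfl
  · rw [extZero, dif_neg (by rwa [Finset.card_insert_of_notMem h])]
    simp

theorem signD_extZero_eq_zero {j : ℕ} (hj : 1 ≤ j) {x : Kos 𝕜 n j} (hx : kosD 𝕜 n j x = 0) :
    signD (kosSign 𝕜) (extZero x) = 0 := by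
  ext1 I
  by_cases hI : I.card + 1 = j
  · have h1 := kosD_restrict hj (extZero x) ⟨I, by omega⟩
    rw [extZero_restrict, hx] at h1
    exact h1.symm
  · exact signD_extZero_of_card_ne _ _ hI

theorem kosD_kosD {k : ℕ} (hk : 2 ≤ k) (x : Kos 𝕜 n k) :
    kosD 𝕜 n (k - 1) (kosD 𝕜 n k x) = 0 := by
  have h1 : kosD 𝕜 n k x = fun J => signD (kosSign 𝕜) (extZero x) J.1 := by
    ext1 J
    conv_lhs => rw [← extZero_restrict x]
    exact kosD_restrict (by omega) _ J
  ext1 I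
  rw [h1, kosD_restrict (by omega), signD_signD isKoszulSign_kosSign]
  rfl

/-- The Koszul complex is exact in positive degrees. -/
theorem ker_kosD {k : ℕ} (hk : 2 ≤ k) : LinearMap.ker (kosD 𝕜 n (k - 1)) = Syz 𝕜 n k := by
  apply le_antisymm
  · intro x hx
    obtain ⟨w, hw⟩ := exists_signD_eq isKoszulSign_kosSign
      (signD_extZero_eq_zero (by omega) (LinearMap.mem_ker.1 hx))
    refine ⟨fun J => w J.1, ?_⟩
    ext1 I
    rw [kosD_restrict (by omega), hw]
    · simp [extZero, I.2]
    · rw [← Finset.card_pos, I.2]; omega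
  · rintro _ ⟨y, rfl⟩
    exact kosD_kosD hk y

/-- A cycle in top degree is a boundary, but there is no index outside `[n]` to adjoin, so this
boundary is an empty sum. -/
theorem kosD_card_injective (hn : 1 ≤ n) : Function.Injective (kosD 𝕜 n n) := by
  rw [← LinearMap.ker_eq_bot, LinearMap.ker_eq_bot']
  intro x hx
  obtain ⟨w, hw⟩ := exists_signD_eq isKoszulSign_kosSign
    (signD_extZero_eq_zero (by omega) hx)
  ext1 I
  have hI : I.1 = Finset.univ := by
    rw [← Finset.card_eq_iff_eq_univ, I.2, Fintype.card_fin]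
  have h1 := hw I.1 (by rw [← Finset.card_pos, I.2]; omega)
  rw [extZero, dif_pos I.2] at h1
  rw [← h1, hI, signD]
  simp

theorem kosD_single {j : ℕ} (J : {J : Finset (Fin n) // J.card = j})
    (I : {J : Finset (Fin n) // J.card = j - 1}) (hj : 1 ≤ j) :
    kosD 𝕜 n j (Pi.single J 1) I = ∑ i ∈ J.1, if I.1 = J.1.erase i then
      (-1) ^ (I.1.filter (· < i)).card * X i else 0 := by
  rw [kosD_apply, ← Finset.sum_subset (Finset.subset_univ J.1)]
  · refine Finset.sum_congr rfl fun i hi => ?_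
    by_cases h : I.1 = J.1.erase i
    · have h2 : insert i I.1 = J.1 := by rw [h, Finset.insert_erase hi]
      have h3 : (insert i I.1).card = j := by rw [h2, J.2]
      rw [dif_pos h3, if_pos h]
      have h4 : (⟨insert i I.1, h3⟩ : {J : Finset (Fin n) // J.card = j}) = J := Subtype.ext h2
      rw [h4, Pi.single_eq_same, mul_one]
    · rw [if_neg h]
      split_ifs with h3
      · rw [Pi.single_eq_of_ne, mul_zero]
        rintro h4
        apply h
        have h5 := (card_insert_eq_iff hj I.2).1 h3
        rw [← h4, Finset.erase_insert h5]
      · rfl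
  · intro i _ hi
    split_ifs with h3
    · rw [Pi.single_eq_of_ne, mul_zero]
      rintro h4
      apply hi
      rw [← h4]; simp
    · rfl

theorem apply_kosD_single {j : ℕ} (ψ : Kos 𝕜 n (j - 1) →ₗ[Poly 𝕜 n] Poly 𝕜 n) (hj : 1 ≤ j)
    (J : {J : Finset (Fin n) // J.card = j}) :
    ψ (kosD 𝕜 n j (Pi.single J 1)) = ∑ i ∈ J.1.attach,
      (-1) ^ ((J.1.erase i).filter (· < i.1)).card * X i.1 *
        ψ (Pi.single ⟨J.1.erase i, by rw [Finset.card_erase_of_mem i.2, J.2]⟩ 1) := by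
  have h : kosD 𝕜 n j (Pi.single J 1) = ∑ i ∈ J.1.attach,
      ((-1) ^ ((J.1.erase i).filter (· < i.1)).card * X i.1 : Poly 𝕜 n) •
        Pi.single (M := fun _ => Poly 𝕜 n) (⟨J.1.erase i, by rw [Finset.card_erase_of_mem i.2, J.2]⟩ :
          {J : Finset (Fin n) // J.card = j - 1}) 1 := by
    ext1 I
    rw [kosD_single J I hj, Finset.sum_apply, ← Finset.sum_attach]
    refine Finset.sum_congr rfl fun i _ => ?_
    rw [Pi.smul_apply]
    by_cases h : I.1 = J.1.erase i.1
    · rw [if_pos h, Pi.single_apply, if_pos (Subtype.ext h), h, smul_eq_mul, mul_one]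
    · rw [if_neg h, Pi.single_apply, if_neg (fun h' => h (congrArg Subtype.val h')), smul_zero]
  rw [h, map_sum]
  simp only [map_smul, smul_eq_mul]

/-- The dual of the Koszul complex is exact except at `K_n^*`. -/
theorem exists_dual_coeff {j : ℕ} (hj : j + 1 ≤ n) {ψ : Kos 𝕜 n j →ₗ[Poly 𝕜 n] Poly 𝕜 n}
    (hψ : ∀ y, ψ (kosD 𝕜 n (j + 1) y) = 0) :
    ∃ w : Finset (Fin n) → Poly 𝕜 n, ∀ J : {J : Finset (Fin n) // J.card = j},
      ψ (Pi.single J 1) = ∑ i ∈ J.1,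
        (-1) ^ ((J.1.erase i).filter (· < i)).card * X i * w (J.1.erase i) := by
  -- Indexing the values of `ψ` by complements turns removal of an index into adjunction, so that `ψ
  -- ∘ ∂ = 0` becomes the cycle condition for `dualSign`.
  set z : Finset (Fin n) → Poly 𝕜 n :=
    fun I => if h : Iᶜ.card = j then ψ (Pi.single ⟨Iᶜ, h⟩ 1) else 0 with hz
  have hfil : ∀ (i : Fin n) (K : Finset (Fin n)),
      (K.erase i).filter (· < i) = K.filter (· < i) := by
    intro i K
    ext k
    simp only [Finset.mem_filter, Finset.mem_erase]
    constructor
    · rintro ⟨⟨_, h⟩, h'⟩; exact ⟨h, h'⟩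
    · rintro ⟨h, h'⟩; exact ⟨⟨h'.ne, h⟩, h'⟩
  have hD : ∀ v : Finset (Fin n) → Poly 𝕜 n, ∀ I, signD (dualSign 𝕜) v I = ∑ i ∈ Iᶜ,
      (-1) ^ ((Iᶜ.erase i).filter (· < i)).card * X i * v (insert i I) := by
    intro v I
    rw [signD, ← Finset.sum_subset (Finset.subset_univ Iᶜ)]
    · refine Finset.sum_congr rfl fun i hi => ?_
      rw [if_neg (Finset.mem_compl.1 hi), MvPolynomial.smul_eq_C_mul, dualSign, hfil]
      simp [mul_assoc]
    · intro i _ hi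
      rw [if_pos (by simpa using hi)]
  have hz0 : signD (dualSign 𝕜) z = 0 := by
    ext1 I
    rw [hD]
    by_cases hI : Iᶜ.card = j + 1
    · have h1 := apply_kosD_single (j := j + 1) ψ (by omega) ⟨Iᶜ, hI⟩
      rw [hψ] at h1
      rw [Pi.zero_apply, h1, ← Finset.sum_attach]
      refine Finset.sum_congr rfl fun i _ => ?_
      have h2 : (insert i.1 I)ᶜ = Iᶜ.erase i := by rw [Finset.compl_insert]
      have h3 : (insert i.1 I)ᶜ.card = j := by
        rw [h2, Finset.card_erase_of_mem i.2, hI]; omega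
      simp only [hz]
      rw [dif_pos h3]
      simp only [h2]
    · refine Finset.sum_eq_zero fun i hi => ?_
      simp only [hz]
      rw [dif_neg, mul_zero]
      rw [Finset.compl_insert, Finset.card_erase_of_mem hi]
      have := Finset.card_pos.2 ⟨i, hi⟩
      omega
  obtain ⟨w, hw⟩ := exists_signD_eq isKoszulSign_dualSign hz0
  refine ⟨fun K => w Kᶜ, fun J => ?_⟩
  -- Exactness is available only at nonempty sets; `Jᶜ` is nonempty because `j < n`.
  have h1 := hw J.1ᶜ (by
    rw [← Finset.card_pos, Finset.card_compl, J.2, Fintype.card_fin]; omega)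
  rw [hD] at h1
  simp only [hz, compl_compl] at h1
  rw [dif_pos J.2] at h1
  rw [← h1]
  refine Finset.sum_congr rfl fun i _ => ?_
  simp only [Finset.compl_erase]

end Koszul

/-! ### Functionals vanishing on syzygies lie in `𝒜` and `ℬ` -/

section DualGenerators

variable {𝕜 : Type*} [Field 𝕜] {n : ℕ}

theorem dualE_single {j : ℕ} (J : Finset (Fin n)) (K : {J : Finset (Fin n) // J.card = j}) :
    dualE 𝕜 n j J (Pi.single K 1) = if J = K.1 then 1 else 0 := by
  unfold dualE
  split_ifs with h h' h'
  · rw [LinearMap.proj_apply, Pi.single_apply, if_pos (Subtype.ext h')]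
  · rw [LinearMap.proj_apply, Pi.single_apply, if_neg fun h2 => h' (congrArg Subtype.val h2)]
  · exact absurd (h' ▸ K.2) h
  · rfl

theorem eq_sum_dualE {j : ℕ} (ψ : Kos 𝕜 n j →ₗ[Poly 𝕜 n] Poly 𝕜 n) {v : Finset (Fin n) → Poly 𝕜 n}
    (hv : ∀ J : {J : Finset (Fin n) // J.card = j}, ψ (Pi.single J 1) = v J.1) :
    ψ = ∑ J ∈ Finset.powersetCard j Finset.univ, v J • dualE 𝕜 n j J := by
  refine LinearMap.pi_ext' fun K => LinearMap.ext_ring ?_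
  simp only [LinearMap.comp_apply, LinearMap.single_apply, LinearMap.sum_apply,
    LinearMap.smul_apply, dualE_single]
  rw [hv, Finset.sum_eq_single K.1]
  · simp
  · intro J _ h; simp [h]
  · intro h; exact absurd (Finset.mem_powersetCard.2 ⟨Finset.subset_univ _, K.2⟩) h

/-- A functional on `K_j` vanishing on `E_{j+1}` is a combination of the images of the `e_I^*`,
`|I| = j - 1`, under the dual of the Koszul differential. -/
theorem exists_eq_sum_dualE {j : ℕ} (hj1 : 1 ≤ j) (hj : j + 1 ≤ n)
    {ψ : Kos 𝕜 n j →ₗ[Poly 𝕜 n] Poly 𝕜 n} (hψ : ∀ y, ψ (kosD 𝕜 n (j + 1) y) = 0) :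
    ∃ w : Finset (Fin n) → Poly 𝕜 n, ψ = ∑ I ∈ Finset.powersetCard (j - 1) Finset.univ,
      w I • ∑ i ∈ Iᶜ, ((-1) ^ (I.filter (· < i)).card * X i : Poly 𝕜 n) •
        dualE 𝕜 n j (insert i I) := by
  obtain ⟨w, hw⟩ := exists_dual_coeff hj hψ
  refine ⟨w, ?_⟩
  rw [eq_sum_dualE ψ (v := fun J => ∑ i ∈ J,
    (-1) ^ ((J.erase i).filter (· < i)).card * X i * w (J.erase i)) hw]
  simp only [Finset.sum_smul, Finset.smul_sum, Finset.sum_sigma']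
  -- Both double sums run over pairs `I ⊂ J` with `J = I ∪ {i}`, once organised by `J` and once by
  -- `I`.
  refine Finset.sum_bij' (fun x _ => ⟨x.1.erase x.2, x.2⟩) (fun x _ => ⟨insert x.2 x.1, x.2⟩)
    ?_ ?_ ?_ ?_ ?_
  · rintro ⟨J, i⟩ h
    simp only [Finset.mem_sigma, Finset.mem_powersetCard_univ, Finset.mem_compl] at h ⊢
    exact ⟨by rw [Finset.card_erase_of_mem h.2, h.1], Finset.notMem_erase _ _⟩
  · rintro ⟨I, i⟩ h
    simp only [Finset.mem_sigma, Finset.mem_powersetCard_univ, Finset.mem_compl] at h ⊢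
    exact ⟨by rw [Finset.card_insert_of_notMem h.2, h.1]; omega, Finset.mem_insert_self _ _⟩
  · rintro ⟨J, i⟩ h
    simp only [Finset.mem_sigma] at h
    simp [Finset.insert_erase h.2]
  · rintro ⟨I, i⟩ h
    simp only [Finset.mem_sigma, Finset.mem_compl] at h
    simp [Finset.erase_insert h.2]
  · rintro ⟨J, i⟩ h
    simp only [Finset.mem_sigma] at h
    simp only [Finset.insert_erase h.2, smul_smul]
    congr 1
    ring

theorem card_filter_product_lt (L I : Finset (Fin n)) :
    ((L ×ˢ I).filter fun x => x.2 < x.1).card = ∑ l ∈ L, (I.filter (· < l)).card := by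
  rw [Finset.card_filter, Finset.sum_product]
  simp only [Finset.card_filter]

/-- Moving `i` from `Iᶜ` to `I` loses the inversions of `i` with smaller elements of `I` and creates
one for each larger element of `Iᶜ`. Together with the elements of `Iᶜ` below `i`, the latter add up
to `|Iᶜ| - 1`. So the signs in a generator of `𝒜` are those of the dual differential up to a factor
independent of `i`. -/
theorem sigma_erase_insert {I : Finset (Fin n)} {i : Fin n} (hi : i ∉ I) :
    (-1 : Poly 𝕜 n) ^ (Iᶜ.filter (· < i)).card * sigma 𝕜 (Iᶜ.erase i) (insert i I) =
      ((-1) ^ (Iᶜ.card + 1) * sigma 𝕜 Iᶜ I) * (-1) ^ (I.filter (· < i)).card := by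
  have hi' : i ∈ Iᶜ := by simpa using hi
  unfold sigma
  rw [card_filter_product_lt, card_filter_product_lt, ← Finset.add_sum_erase _ _ hi']
  have h1 : ∑ l ∈ Iᶜ.erase i, ((insert i I).filter (· < l)).card =
      ∑ l ∈ Iᶜ.erase i, (I.filter (· < l)).card + ((Iᶜ.erase i).filter (i < ·)).card := by
    rw [Finset.card_filter (i < ·), ← Finset.sum_add_distrib]
    refine Finset.sum_congr rfl fun l _ => ?_
    rw [Finset.filter_insert]
    split_ifs
    · rw [Finset.card_insert_of_notMem (by simp [hi])]
    · rfl
  have h2 : (Iᶜ.filter (· < i)).card + ((Iᶜ.erase i).filter (i < ·)).card + 1 = Iᶜ.card := by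
    rw [← Finset.card_erase_add_one hi', ← Finset.card_union_of_disjoint]
    · congr 2
      ext k
      simp only [Finset.mem_union, Finset.mem_filter, Finset.mem_erase]
      constructor
      · rintro (⟨h, h'⟩ | ⟨h, _⟩)
        · exact ⟨h'.ne, h⟩
        · exact h
      · rintro ⟨h, h'⟩
        rcases lt_or_gt_of_ne h with h3 | h3
        · exact Or.inl ⟨h', h3⟩
        · exact Or.inr ⟨⟨h, h'⟩, h3⟩
    · rw [Finset.disjoint_left]
      intro k hk hk'
      exact lt_asymm (Finset.mem_filter.1 hk).2 (Finset.mem_filter.1 hk').2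
  rw [h1, ← h2]
  set A := (Iᶜ.filter (· < i)).card
  set B := ((Iᶜ.erase i).filter (i < ·)).card
  set C := ∑ l ∈ Iᶜ.erase i, (I.filter (· < l)).card
  set D := (I.filter (· < i)).card
  have hD : ((-1 : Poly 𝕜 n) ^ D) * (-1) ^ D = 1 := by rw [← mul_pow]; simp
  calc _ = (-1 : Poly 𝕜 n) ^ A * ((-1) ^ C * (-1) ^ B) * (((-1) ^ D) * (-1) ^ D) := by
        rw [hD, mul_one, pow_add]
    _ = _ := by ring

/-- By dual exactness `ψ` is a combination of the images of the `e_I^*` with `|I| = t`, and each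
image is, up to sign, the generator with `L = Iᶜ`. -/
theorem mem_calA {t : ℕ} (ht : t + 2 ≤ n) {ψ : Kos 𝕜 n (t + 1) →ₗ[Poly 𝕜 n] Poly 𝕜 n}
    (hψ : ∀ y, ψ (kosD 𝕜 n (t + 2) y) = 0) : ψ ∈ calA 𝕜 n t := by
  obtain ⟨w, rfl⟩ := exists_eq_sum_dualE (j := t + 1) (by omega) ht hψ
  refine Submodule.sum_mem _ fun I hI => Submodule.smul_mem _ _ ?_
  have hI' : I.card = t := by simpa using hI
  set s : Poly 𝕜 n := (-1) ^ (Iᶜ.card + 1) * sigma 𝕜 Iᶜ I with hs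
  have hss : s * s = 1 := by
    simp only [hs, sigma]
    rw [mul_mul_mul_comm, ← mul_pow, ← mul_pow]; simp
  have hgen : s • ∑ i ∈ Iᶜ, ((-1) ^ (I.filter (· < i)).card * X i : Poly 𝕜 n) •
      dualE 𝕜 n (t + 1) (insert i I) ∈ calA 𝕜 n t := by
    refine Submodule.subset_span ⟨Iᶜ, ?_, ?_⟩
    · rw [Finset.card_compl, hI', Fintype.card_fin]
    · rw [Finset.smul_sum]
      refine Finset.sum_congr rfl fun i hi => ?_
      rw [compl_compl, smul_smul, sigma_erase_insert (Finset.mem_compl.1 hi), ← mul_assoc]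
  have h := Submodule.smul_mem _ s hgen
  rwa [smul_smul, hss, one_smul] at h

theorem card_filter_lt_compl_pair {i j : Fin n} (hij : i < j) :
    ((({i, j} : Finset (Fin n))ᶜ).filter (· < i)).card = i ∧
      ((({i, j} : Finset (Fin n))ᶜ).filter (· < j)).card + 1 = j := by
  constructor
  · have h : (({i, j} : Finset (Fin n))ᶜ).filter (· < i) = Finset.Iio i := by
      ext k
      simp only [Finset.mem_filter, Finset.mem_compl, Finset.mem_insert, Finset.mem_singleton,
        Finset.mem_Iio, and_iff_right_iff_imp]
      intro h
      push Not
      exact ⟨h.ne, (h.trans hij).ne⟩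
    rw [h, Fin.card_Iio]
  · have h : (({i, j} : Finset (Fin n))ᶜ).filter (· < j) = (Finset.Iio j).erase i := by
      ext k
      simp only [Finset.mem_filter, Finset.mem_compl, Finset.mem_insert, Finset.mem_singleton,
        Finset.mem_Iio, Finset.mem_erase]
      constructor
      · rintro ⟨h, h'⟩; push Not at h; exact ⟨h.1, h'⟩
      · rintro ⟨h, h'⟩; exact ⟨by push Not; exact ⟨h, h'.ne⟩, h'⟩
    rw [h, Finset.card_erase_add_one (by simpa using hij), Fin.card_Iio]

/-- Here `|I| = n - 2`, so the image of `e_I^*` has two terms, indexed by the two elements of `Iᶜ`.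
-/
theorem mem_calB (hn : 2 ≤ n) {ψ : Kos 𝕜 n (n - 1) →ₗ[Poly 𝕜 n] Poly 𝕜 n}
    (hψ : ∀ y, ψ (kosD 𝕜 n n y) = 0) : ψ ∈ calB 𝕜 n := by
  obtain ⟨m, rfl⟩ : ∃ m, n = m + 1 := ⟨n - 1, by omega⟩
  obtain ⟨w, rfl⟩ := exists_eq_sum_dualE (j := m) (by omega) le_rfl hψ
  refine Submodule.sum_mem _ fun I hI => Submodule.smul_mem _ _ ?_
  have hI' : Iᶜ.card = 2 := by
    rw [Finset.card_compl, Finset.mem_powersetCard_univ.1 hI, Fintype.card_fin]; omega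
  obtain ⟨i, j, hij, hIij⟩ : ∃ i j : Fin (m + 1), i < j ∧ Iᶜ = {i, j} := by
    obtain ⟨i, j, hne, h⟩ := Finset.card_eq_two.1 hI'
    rcases lt_or_gt_of_ne hne with h' | h'
    · exact ⟨i, j, h', h⟩
    · exact ⟨j, i, h', by rw [h, Finset.pair_comm]⟩
  have hI2 : I = ({i, j} : Finset (Fin (m + 1)))ᶜ := by rw [← hIij, compl_compl]
  obtain ⟨h1, h2⟩ := card_filter_lt_compl_pair hij
  have h3 : insert i I = Finset.univ.erase j := by
    rw [hI2]; ext k; by_cases hk : k = i <;> simp [hk, hij.ne]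
  have h4 : insert j I = Finset.univ.erase i := by
    rw [hI2]; ext k; by_cases hk : k = j <;> simp [hk, hij.ne']
  rw [hIij, Finset.sum_pair hij.ne, h3, h4]
  have hgen : ((-1) ^ ((i : ℕ) + 1) * X j : Poly 𝕜 (m + 1)) •
        dualE 𝕜 (m + 1) (m + 1 - 1) (Finset.univ.erase i) -
      ((-1) ^ ((j : ℕ) + 1) * X i : Poly 𝕜 (m + 1)) •
        dualE 𝕜 (m + 1) (m + 1 - 1) (Finset.univ.erase j) ∈ calB 𝕜 (m + 1) :=
    Submodule.subset_span ⟨i, j, hij, rfl⟩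
  -- The image of `e_I^*` has signs `(-1)^i` at `x_i` and `(-1)^(j-1)` at `x_j`, for indices counted
  -- from zero; the factor `(-1)^(i+j)` produces them from the generator.
  have h := Submodule.smul_mem _ ((-1) ^ ((i : ℕ) + j) : Poly 𝕜 (m + 1)) hgen
  convert h using 1
  rw [smul_sub, smul_smul, smul_smul, hI2, h1]
  set B := ((({i, j} : Finset (Fin (m + 1)))ᶜ).filter (· < j)).card
  have hA : ((-1 : Poly 𝕜 (m + 1)) ^ (i : ℕ)) * (-1) ^ (i : ℕ) = 1 := by rw [← mul_pow]; simp
  have hB : ((-1 : Poly 𝕜 (m + 1)) ^ B) * (-1) ^ B = 1 := by rw [← mul_pow]; simp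
  rw [← h2]
  have e1 : ((-1) ^ ((i : ℕ) + (B + 1)) * ((-1) ^ ((i : ℕ) + 1) * X j) : Poly 𝕜 (m + 1)) =
      (-1) ^ B * X j := by
    calc _ = ((-1) ^ (i : ℕ) * (-1) ^ (i : ℕ)) * (-1) ^ B * X j := by ring
      _ = _ := by rw [hA, one_mul]
  have e2 : ((-1) ^ ((i : ℕ) + (B + 1)) * ((-1) ^ (B + 1 + 1) * X i) : Poly 𝕜 (m + 1)) =
      -((-1) ^ (i : ℕ) * X i) := by
    calc _ = -((-1) ^ (i : ℕ) * ((-1) ^ B * (-1) ^ B) * X i) := by ring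
      _ = _ := by rw [hB, mul_one]
  rw [e1, e2, neg_smul, sub_neg_eq_add]
  exact add_comm _ _

end DualGenerators

/-! ### Ranks and non-projectivity of the syzygy modules -/

section Homological

variable {𝕜 : Type*} [Field 𝕜] {n : ℕ}

/-- The differential `∂_k` as a map onto the syzygy module `E_k`. -/
noncomputable def toSyz (𝕜 : Type*) [Field 𝕜] (n k : ℕ) : Kos 𝕜 n k →ₗ[Poly 𝕜 n] Syz 𝕜 n k :=
  (kosD 𝕜 n k).rangeRestrict

theorem coe_toSyz (k : ℕ) (x : Kos 𝕜 n k) : (toSyz 𝕜 n k x : Kos 𝕜 n (k - 1)) = kosD 𝕜 n k x :=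
  rfl

theorem toSyz_surjective (k : ℕ) : Function.Surjective (toSyz 𝕜 n k) :=
  LinearMap.surjective_rangeRestrict _

theorem toSyz_eq_zero {k : ℕ} {x : Kos 𝕜 n k} : toSyz 𝕜 n k x = 0 ↔ kosD 𝕜 n k x = 0 :=
  Subtype.ext_iff

theorem mem_syz_iff {k : ℕ} (hk : 2 ≤ k) {x : Kos 𝕜 n (k - 1)} :
    x ∈ Syz 𝕜 n k ↔ kosD 𝕜 n (k - 1) x = 0 := by
  rw [← ker_kosD hk, LinearMap.mem_ker]

theorem mem_syz_add_two_iff {k : ℕ} {x : Kos 𝕜 n (k + 1)} :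
    x ∈ Syz 𝕜 n (k + 2) ↔ kosD 𝕜 n (k + 1) x = 0 :=
  mem_syz_iff (k := k + 2) (by omega)

theorem finrank_range_add_finrank_ker' {R M M' : Type*} [CommRing R] [IsDomain R]
    [AddCommGroup M] [Module R M] [Module.Finite R M] [AddCommGroup M'] [Module R M']
    (f : M →ₗ[R] M') : Module.finrank R (LinearMap.range f) +
      Module.finrank R (LinearMap.ker f) = Module.finrank R M := by
  rw [← (LinearMap.ker f).finrank_quotient_add_finrank, f.quotKerEquivRange.finrank_eq]

theorem exists_lift_of_range_le {R κ P M : Type*} [CommRing R] [Fintype κ] [AddCommGroup P]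
    [Module R P] [AddCommGroup M] [Module R M] (h : (κ → R) →ₗ[R] M) (g : P →ₗ[R] M)
    (hr : LinearMap.range h ≤ LinearMap.range g) : ∃ s : (κ → R) →ₗ[R] P, g ∘ₗ s = h := by
  classical
  choose y hy using fun k : κ => hr ⟨Pi.single k 1, rfl⟩
  refine ⟨Fintype.linearCombination R y, LinearMap.pi_ext' fun k => LinearMap.ext_ring ?_⟩
  simp [hy]

theorem exists_factor_of_injective {R M P Q : Type*} [CommRing R] [AddCommGroup P]
    [Module R P] [AddCommGroup M] [Module R M] [AddCommGroup Q] [Module R Q] (h : Q →ₗ[R] M)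
    (f : P →ₗ[R] M) (hf : Function.Injective f)
    (hr : LinearMap.range h ≤ LinearMap.range f) : ∃ l : Q →ₗ[R] P, f ∘ₗ l = h := by
  refine ⟨(LinearEquiv.ofInjective f hf).symm.toLinearMap ∘ₗ
    h.codRestrict (LinearMap.range f) (fun x => hr ⟨x, rfl⟩), LinearMap.ext fun x => ?_⟩
  have := LinearEquiv.apply_symm_apply (LinearEquiv.ofInjective f hf)
    (h.codRestrict (LinearMap.range f) (fun x => hr ⟨x, rfl⟩) x)
  exact congrArg Subtype.val this

/-- Minimality of the Koszul complex, `E_k ⊆ 𝔪 K_{k-1}`: the matrix entries of `∂_k` are zero or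
signed variables. Both the non-projectivity of syzygies and the Nakayama argument rest on it. -/
theorem constantCoeff_of_mem_syz {k : ℕ} {x : Kos 𝕜 n (k - 1)} (hx : x ∈ Syz 𝕜 n k)
    (I : {J : Finset (Fin n) // J.card = k - 1}) : constantCoeff (x I) = 0 := by
  obtain ⟨y, rfl⟩ := hx
  rw [kosD_apply, map_sum]
  refine Finset.sum_eq_zero fun i _ => ?_
  split_ifs <;> simp

theorem kosD_ne_zero {k : ℕ} (hk1 : 1 ≤ k) (hk : k ≤ n) :
    ∃ (J : {J : Finset (Fin n) // J.card = k}) (i : Fin n)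
      (I : {J : Finset (Fin n) // J.card = k - 1}),
      kosD 𝕜 n k (Pi.single J 1) I = X i ∨ kosD 𝕜 n k (Pi.single J 1) I = -X i := by
  obtain ⟨J, hJ⟩ : ∃ J : Finset (Fin n), J.card = k := by
    obtain ⟨J, -, hJ⟩ := Finset.exists_subset_card_eq (s := (Finset.univ : Finset (Fin n)))
      (n := k) (by simpa using hk)
    exact ⟨J, hJ⟩
  obtain ⟨i, hi⟩ : J.Nonempty := by rw [← Finset.card_pos]; omega
  refine ⟨⟨J, hJ⟩, i, ⟨J.erase i, by rw [Finset.card_erase_of_mem hi, hJ]⟩, ?_⟩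
  rw [kosD_single _ _ hk1, Finset.sum_eq_single_of_mem i hi]
  · rw [if_pos rfl]
    rcases neg_one_pow_eq_or (Poly 𝕜 n) ((J.erase i).filter (· < i)).card with h | h
    · left; rw [h, one_mul]
    · right; rw [h, neg_one_mul]
  · intro j hj hji
    rw [if_neg]
    intro h
    have : j ∈ J.erase i := Finset.mem_erase.2 ⟨hji, hj⟩
    dsimp only at h
    rw [h] at this
    exact Finset.notMem_erase _ _ this

theorem finrank_prod' {R M M' : Type*} [CommRing R] [IsDomain R]
    [AddCommGroup M] [Module R M] [Module.Finite R M] [AddCommGroup M'] [Module R M']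
    [Module.Finite R M'] :
    Module.finrank R (M × M') = Module.finrank R M + Module.finrank R M' := by
  rw [← finrank_range_add_finrank_ker' (LinearMap.snd R M M'), LinearMap.ker_snd,
    LinearMap.finrank_range_of_inj LinearMap.inl_injective, Submodule.range_snd, finrank_top,
    add_comm]

/-- A syzygy module that is not the last one is not projective. -/
theorem not_projective_syz {k : ℕ} (hk : 2 ≤ k) (hkn : k + 1 ≤ n) :
    ¬ Module.Projective (Poly 𝕜 n) (Syz 𝕜 n k) := by
  intro hP
  obtain ⟨σ, hσ⟩ := Module.projective_lifting_property (toSyz 𝕜 n k)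
    (LinearMap.id : Syz 𝕜 n k →ₗ[Poly 𝕜 n] Syz 𝕜 n k) (toSyz_surjective k)
  -- A splitting of `∂_k` gives a retraction `r` of `K_k` onto `E_{k+1}`.
  set r : Kos 𝕜 n k →ₗ[Poly 𝕜 n] Kos 𝕜 n k :=
    LinearMap.id - σ ∘ₗ toSyz 𝕜 n k with hr
  have hker : ∀ x, r x ∈ Syz 𝕜 n (k + 1) := by
    intro x
    rw [← ker_kosD (k := k + 1) (by omega), LinearMap.mem_ker]
    have h1 := congrArg Subtype.val (LinearMap.congr_fun hσ (toSyz 𝕜 n k x))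
    change kosD 𝕜 n k (r x) = 0
    rw [hr, LinearMap.sub_apply, map_sub, sub_eq_zero]
    exact h1.symm
  have hid : ∀ x, kosD 𝕜 n k x = 0 → r x = x := by
    intro x hx
    have h1 : toSyz 𝕜 n k x = 0 := toSyz_eq_zero.2 hx
    rw [hr, LinearMap.sub_apply, LinearMap.comp_apply, h1, map_zero, sub_zero, LinearMap.id_apply]
  obtain ⟨J, i, I, hJ⟩ := kosD_ne_zero (𝕜 := 𝕜) (n := n) (k := k + 1) (by omega) hkn
  set e : Kos 𝕜 n k := kosD 𝕜 n (k + 1) (Pi.single J 1) with he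
  have he0 : kosD 𝕜 n k e = 0 := kosD_kosD (k := k + 1) (by omega) _
  have hsum : e = ∑ K, e K • r (Pi.single K 1) := by
    conv_lhs => rw [← hid e he0, pi_eq_sum_univ' e]
    rw [map_sum]
    simp only [map_smul]
  -- Since `e = ∑ e_K r(e_K)` and both factors have entries in `𝔪`, the entries of `e` lie in `𝔪²`
  -- and have no linear term; yet one of them is `±x_i`.
  have hpd : constantCoeff (pderiv i (e I)) = 0 := by
    rw [hsum, Finset.sum_apply, map_sum, map_sum]
    refine Finset.sum_eq_zero fun K _ => ?_
    have h1 : constantCoeff (e K) = 0 := constantCoeff_of_mem_syz (k := k + 1) ⟨_, rfl⟩ K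
    have h2 : constantCoeff (r (Pi.single K 1) I) = 0 :=
      constantCoeff_of_mem_syz (k := k + 1) (hker _) I
    rw [Pi.smul_apply, smul_eq_mul, pderiv_mul, map_add, map_mul, map_mul, h1, h2]
    ring
  rcases hJ with h | h
  · change e I = X i at h
    rw [h] at hpd
    simp at hpd
  · change e I = -X i at h
    rw [h] at hpd
    simp at hpd

/-- `E_1` is a nonzero submodule of the rank one module `K_0`. Rank-nullity for `∂_k` then gives
`rank E_k + rank E_{k+1} = C(n, k)`, and Pascal's rule concludes. -/
theorem finrank_syz {k : ℕ} (hk : 1 ≤ k) (hn : 1 ≤ n) :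
    Module.finrank (Poly 𝕜 n) (Syz 𝕜 n k) = (n - 1).choose (k - 1) := by
  have hK : ∀ j, Module.finrank (Poly 𝕜 n) (Kos 𝕜 n j) = n.choose j := by
    intro j
    rw [Module.finrank_fintype_fun_eq_card, Fintype.card_finset_len, Fintype.card_fin]
  induction k, hk using Nat.le_induction with
  | base =>
    apply le_antisymm
    · refine (Submodule.finrank_le _).trans ?_
      rw [hK]; simp
    · refine (Nat.choose_zero_right (n - 1)).le.trans ?_
      rw [Nat.one_le_iff_ne_zero, ← Nat.pos_iff_ne_zero, Module.finrank_pos_iff_exists_ne_zero]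
      obtain ⟨J, i, I, hJ⟩ := kosD_ne_zero (𝕜 := 𝕜) (n := n) (k := 1) le_rfl hn
      refine ⟨⟨_, ⟨Pi.single J 1, rfl⟩⟩, fun h => ?_⟩
      have h1 := congrFun (congrArg Subtype.val h) I
      change kosD 𝕜 n 1 (Pi.single J 1) I = 0 at h1
      rw [h1] at hJ
      rcases hJ with h | h
      · exact X_ne_zero i h.symm
      · exact X_ne_zero i (neg_eq_zero.1 h.symm)
  | succ k hk ih =>
    have h1 := finrank_range_add_finrank_ker' (kosD 𝕜 n k)
    have h2 : Module.finrank (Poly 𝕜 n) (LinearMap.ker (kosD 𝕜 n k)) =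
        Module.finrank (Poly 𝕜 n) (Syz 𝕜 n (k + 1)) := by
      rw [← ker_kosD (k := k + 1) (by omega)]; rfl
    change Module.finrank (Poly 𝕜 n) (Syz 𝕜 n k) + _ = _ at h1
    rw [ih, h2, hK] at h1
    obtain ⟨m, rfl⟩ : ∃ m, n = m + 1 := ⟨n - 1, by omega⟩
    obtain ⟨l, rfl⟩ : ∃ l, k = l + 1 := ⟨k - 1, by omega⟩
    simp only [Nat.add_sub_cancel] at h1 ⊢
    rw [Nat.choose_succ_succ] at h1
    exact Nat.add_left_cancel h1

/-- The approximation module has projective dimension at least two on its first summand, so that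
`φ` cannot vanish there. -/
theorem exists_phi_inl_ne_zero {t p q : ℕ} (ht : t + 3 ≤ n)
    {f : (Fin p → Poly 𝕜 n) →ₗ[Poly 𝕜 n] (Fin q → Poly 𝕜 n)}
    {g : (Fin q → Poly 𝕜 n) →ₗ[Poly 𝕜 n] EE 𝕜 n t} {φ : EE 𝕜 n t →ₗ[Poly 𝕜 n] Poly 𝕜 n}
    (hf : Function.Injective f) (hfg : Function.Exact f g) (hgφ : Function.Exact g φ) :
    ∃ x, φ (x, 0) ≠ 0 := by
  by_contra! h0
  -- If `φ` vanishes on `E_{t+1}`, then `E_{t+1} ⊕ 0 ⊆ Im g`, so `∂_{t+1}` lifts along `g` to a map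
  -- `s` from `K_{t+1}` to `G`.
  obtain ⟨s, hs⟩ := exists_lift_of_range_le
    (LinearMap.inl (Poly 𝕜 n) (Syz 𝕜 n (t + 1)) (Syz 𝕜 n (n - 1)) ∘ₗ
      toSyz 𝕜 n (t + 1)) g (by
      rintro _ ⟨x, rfl⟩
      exact (hgφ _).1 (h0 _))
  obtain ⟨β, hβ⟩ := exists_lift_of_range_le
    (LinearMap.fst (Poly 𝕜 n) (Syz 𝕜 n (t + 1)) (Syz 𝕜 n (n - 1)) ∘ₗ g)
    (toSyz 𝕜 n (t + 1)) (fun x _ => toSyz_surjective _ x)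
  have hβ' : ∀ y, kosD 𝕜 n (t + 1) (β y) = (g y).1.1 := fun y =>
    congrArg Subtype.val (LinearMap.congr_fun hβ y)
  have hs' : ∀ k, g (s k) = (toSyz 𝕜 n (t + 1) k, 0) := fun k =>
    LinearMap.congr_fun hs k
  obtain ⟨ι, hι⟩ := exists_factor_of_injective (s ∘ₗ (Syz 𝕜 n (t + 2)).subtype) f hf (by
    rintro _ ⟨x, rfl⟩
    refine (hfg _).1 ?_
    have hx : toSyz 𝕜 n (t + 1) x.1 = 0 := toSyz_eq_zero.2 (mem_syz_add_two_iff.1 x.2)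
    exact (hs' _).trans (Prod.ext hx rfl))
  -- A comparison of resolutions: `s` sends `E_{t+2}` into `Ker g = F`, and `ρ` retracts `F ⊕
  -- K_{t+1}` onto the copy of `E_{t+2}` so embedded, which would therefore be projective.
  let ρ : (Fin p → Poly 𝕜 n) × Kos 𝕜 n (t + 1) →ₗ[Poly 𝕜 n] Syz 𝕜 n (t + 2) :=
    LinearMap.codRestrict _ ((β ∘ₗ f).coprod (LinearMap.id - β ∘ₗ s)) (by
      rintro ⟨x, k⟩
      refine mem_syz_add_two_iff.2 ?_
      change kosD 𝕜 n (t + 1) (β (f x) + (k - β (s k))) = 0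
      have h1 : g (f x) = 0 := (hfg _).2 ⟨x, rfl⟩
      rw [map_add, map_sub, hβ', hβ', h1, hs', coe_toSyz]
      simp)
  refine not_projective_syz (𝕜 := 𝕜) (n := n) (k := t + 2) (by omega) (by omega) ?_
  refine Module.Projective.of_split (ι.prod (Syz 𝕜 n (t + 2)).subtype) ρ ?_
  ext1 x
  apply Subtype.ext
  have h1 : f (ι x) = s x.1 := LinearMap.congr_fun hι x
  have h2 : ∀ (k : Kos 𝕜 n (t + 1)) (y : Fin p → Poly 𝕜 n), f y = s k →
      β (f y) + (k - β (s k)) = k := fun k y h => by rw [h, add_sub_cancel]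
  exact h2 x.1 _ h1

theorem finrank_range_of_ne_zero {M : Type*} [AddCommGroup M] [Module (Poly 𝕜 n) M]
    {φ : M →ₗ[Poly 𝕜 n] Poly 𝕜 n} {x : M} (hx : φ x ≠ 0) :
    Module.finrank (Poly 𝕜 n) (LinearMap.range φ) = 1 := by
  apply le_antisymm
  · refine (Submodule.finrank_le _).trans ?_
    rw [Module.finrank_self]
  · rw [Nat.one_le_iff_ne_zero, ← Nat.pos_iff_ne_zero, Module.finrank_pos_iff_exists_ne_zero]
    exact ⟨⟨φ x, x, rfl⟩, fun h => hx (congrArg Subtype.val h)⟩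

/-- The alternating sum of ranks vanishes, with `rank E_{t+1} = C(n-1, t)`, `rank E_{n-1} = n - 1`
and, as `φ ≠ 0`, rank one for its image. -/
theorem rank_formula {t p q : ℕ} (ht : t + 4 ≤ n)
    {f : (Fin p → Poly 𝕜 n) →ₗ[Poly 𝕜 n] (Fin q → Poly 𝕜 n)}
    {g : (Fin q → Poly 𝕜 n) →ₗ[Poly 𝕜 n] EE 𝕜 n t} {φ : EE 𝕜 n t →ₗ[Poly 𝕜 n] Poly 𝕜 n}
    (hf : Function.Injective f) (hfg : Function.Exact f g) (hgφ : Function.Exact g φ) :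
    (p : ℤ) = q - n + 2 - (n - 1).choose t := by
  obtain ⟨x, hx⟩ := exists_phi_inl_ne_zero (by omega) hf hfg hgφ
  have h1 := finrank_range_add_finrank_ker' g
  have h2 := finrank_range_add_finrank_ker' φ
  rw [finrank_range_of_ne_zero hx, LinearMap.exact_iff.1 hgφ, finrank_prod',
    finrank_syz (by omega) (by omega), finrank_syz (by omega) (by omega)] at h2
  rw [LinearMap.exact_iff.1 hfg, LinearMap.finrank_range_of_inj hf,
    Module.finrank_fin_fun, Module.finrank_fin_fun] at h1
  obtain ⟨m, rfl⟩ : ∃ m, n = m + 2 := ⟨n - 2, by omega⟩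
  have h3 : (m + 2 - 1).choose (m + 2 - 1 - 1) = m + 1 := Nat.choose_succ_self_right m
  rw [h3] at h2
  simp only [show m + 2 - 1 = m + 1 from rfl, Nat.add_sub_cancel] at h2 ⊢
  push_cast
  omega

end Homological

/-! ### Free modules with weights, homogeneous components and graded maps -/

section WeightedGradings

variable {𝕜 : Type*} [Field 𝕜] {n : ℕ}

theorem mem_polyGr_of_isHomogeneous {f : Poly 𝕜 n} {m : ℕ} (hf : f.IsHomogeneous m) :
    f ∈ polyGr 𝕜 n m := by
  rw [polyGr, if_pos (by omega)]
  exact hf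

theorem eq_zero_of_mem_polyGr_neg {f : Poly 𝕜 n} {e : ℤ} (he : e < 0) (hf : f ∈ polyGr 𝕜 n e) :
    f = 0 := by
  rwa [polyGr, if_neg (by omega), Submodule.mem_bot] at hf

theorem isHomogeneous_of_mem_polyGr {f : Poly 𝕜 n} {e : ℤ} (he : 0 ≤ e)
    (hf : f ∈ polyGr 𝕜 n e) : f.IsHomogeneous e.toNat := by
  rwa [polyGr, if_pos he] at hf

theorem mul_mem_polyGr {f g : Poly 𝕜 n} {e e' : ℤ} (hf : f ∈ polyGr 𝕜 n e)
    (hg : g ∈ polyGr 𝕜 n e') : f * g ∈ polyGr 𝕜 n (e + e') := by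
  rcases lt_or_ge e 0 with he | he
  · rw [eq_zero_of_mem_polyGr_neg he hf, zero_mul]; exact zero_mem _
  rcases lt_or_ge e' 0 with he' | he'
  · rw [eq_zero_of_mem_polyGr_neg he' hg, mul_zero]; exact zero_mem _
  have h := mem_polyGr_of_isHomogeneous
    ((isHomogeneous_of_mem_polyGr he hf).mul (isHomogeneous_of_mem_polyGr he' hg))
  rwa [Nat.cast_add, Int.toNat_of_nonneg he, Int.toNat_of_nonneg he'] at h

theorem C_mem_polyGr (r : 𝕜) : (C r : Poly 𝕜 n) ∈ polyGr 𝕜 n 0 :=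
  mem_polyGr_of_isHomogeneous (isHomogeneous_C _ _)

theorem one_mem_polyGr : (1 : Poly 𝕜 n) ∈ polyGr 𝕜 n 0 :=
  mem_polyGr_of_isHomogeneous (isHomogeneous_one _ _)

theorem X_mem_polyGr (i : Fin n) : (X i : Poly 𝕜 n) ∈ polyGr 𝕜 n 1 :=
  mem_polyGr_of_isHomogeneous (isHomogeneous_X _ _)

theorem neg_one_pow_mul_mem_polyGr {f : Poly 𝕜 n} {e : ℤ} (m : ℕ) (hf : f ∈ polyGr 𝕜 n e) :
    (-1) ^ m * f ∈ polyGr 𝕜 n e := by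
  rcases neg_one_pow_eq_or (Poly 𝕜 n) m with h | h
  · rwa [h, one_mul]
  · rw [h, neg_one_mul]; exact neg_mem hf

/-- The homogeneous component of integral degree `e` of a polynomial. -/
noncomputable def polyComp (e : ℤ) : Poly 𝕜 n →ₗ[𝕜] Poly 𝕜 n :=
  if 0 ≤ e then homogeneousComponent e.toNat else 0

theorem polyComp_mem (e : ℤ) (f : Poly 𝕜 n) : polyComp e f ∈ polyGr 𝕜 n e := by
  unfold polyComp polyGr
  split_ifs
  · exact homogeneousComponent_mem _ _
  · simp

theorem polyComp_of_mem {e : ℤ} {f : Poly 𝕜 n} (hf : f ∈ polyGr 𝕜 n e) : polyComp e f = f := by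
  unfold polyComp
  split_ifs with h
  · rw [homogeneousComponent_of_mem (isHomogeneous_of_mem_polyGr h hf), if_pos rfl]
  · rw [eq_zero_of_mem_polyGr_neg (by omega) hf, map_zero]

theorem polyComp_of_mem_of_ne {e e' : ℤ} {f : Poly 𝕜 n} (hf : f ∈ polyGr 𝕜 n e) (h : e ≠ e') :
    polyComp e' f = 0 := by
  rcases lt_or_ge e 0 with he | he
  · rw [eq_zero_of_mem_polyGr_neg he hf, map_zero]
  unfold polyComp
  split_ifs with h'
  · rw [homogeneousComponent_of_mem (isHomogeneous_of_mem_polyGr he hf), if_neg (by omega)]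
  · rfl

theorem polyComp_zero (f : Poly 𝕜 n) : polyComp 0 f = C (constantCoeff f) := by
  rw [polyComp, if_pos le_rfl, Int.toNat_zero, homogeneousComponent_zero, constantCoeff_eq]

theorem eq_C_of_mem_polyGr_zero {f : Poly 𝕜 n} (hf : f ∈ polyGr 𝕜 n 0) :
    f = C (constantCoeff f) := by
  rw [← polyComp_zero, polyComp_of_mem hf]

theorem eq_zero_of_constantCoeff_ne_zero {f : Poly 𝕜 n} {e : ℤ} (hf : f ∈ polyGr 𝕜 n e)
    (h : constantCoeff f ≠ 0) : e = 0 := by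
  by_contra he
  have h1 := polyComp_of_mem_of_ne hf he
  rw [polyComp_zero, C_eq_zero] at h1
  exact h h1

variable {ι κ μ : Type*}

/-- The grading of the free module with basis elements of degrees `w i`. -/
noncomputable def wGr (𝕜 : Type*) [Field 𝕜] (n : ℕ) (w : ι → ℤ) (e : ℤ) : Submodule 𝕜 (ι → Poly 𝕜 n) :=
  Submodule.pi Set.univ fun i => polyGr 𝕜 n (e - w i)

theorem mem_wGr {w : ι → ℤ} {e : ℤ} {x : ι → Poly 𝕜 n} :
    x ∈ wGr 𝕜 n w e ↔ ∀ i, x i ∈ polyGr 𝕜 n (e - w i) := by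
  simp [wGr, Submodule.mem_pi]

theorem freeGr_eq {q : ℕ} (b : Fin q → ℤ) : freeGr 𝕜 n b = wGr 𝕜 n b := by
  ext e x
  simp [freeGr, wGr, shift, neg_add_eq_sub]

theorem shift_kosGr_eq (j : ℕ) (d : ℤ) :
    shift (kosGr 𝕜 n j) d = wGr 𝕜 n fun _ => (j : ℤ) - d := by
  ext e x
  have h : -(j : ℤ) + (d + e) = e - (j - d) := by ring
  simp [kosGr, wGr, shift, h]

theorem kosGr_eq (j : ℕ) : kosGr 𝕜 n j = wGr 𝕜 n fun _ => (j : ℤ) := by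
  ext e x
  simp [kosGr, wGr, shift, neg_add_eq_sub]

theorem smul_mem_wGr {w : ι → ℤ} {e e' : ℤ} {x : ι → Poly 𝕜 n} {f : Poly 𝕜 n}
    (hf : f ∈ polyGr 𝕜 n e') (hx : x ∈ wGr 𝕜 n w e) : f • x ∈ wGr 𝕜 n w (e' + e) := by
  rw [mem_wGr] at hx ⊢
  intro i
  have h := mul_mem_polyGr hf (hx i)
  rwa [← add_sub_assoc] at h

theorem single_mem_wGr [DecidableEq ι] {w : ι → ℤ} {e : ℤ} {f : Poly 𝕜 n} (i : ι)
    (hf : f ∈ polyGr 𝕜 n (e - w i)) : Pi.single i f ∈ wGr 𝕜 n w e := by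
  rw [mem_wGr]
  intro j
  by_cases h : j = i
  · subst h; simpa using hf
  · rw [Pi.single_eq_of_ne h]; exact zero_mem _

/-- The homogeneous component of degree `e` in a free module with weights `w`. -/
noncomputable def compW (w : ι → ℤ) (e : ℤ) : (ι → Poly 𝕜 n) →ₗ[𝕜] (ι → Poly 𝕜 n) :=
  LinearMap.pi fun i => polyComp (e - w i) ∘ₗ LinearMap.proj i

theorem compW_apply (w : ι → ℤ) (e : ℤ) (x : ι → Poly 𝕜 n) (i : ι) :
    compW w e x i = polyComp (e - w i) (x i) := rfl

theorem compW_mem (w : ι → ℤ) (e : ℤ) (x : ι → Poly 𝕜 n) : compW w e x ∈ wGr 𝕜 n w e :=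
  mem_wGr.2 fun _ => polyComp_mem _ _

theorem compW_of_mem {w : ι → ℤ} {e : ℤ} {x : ι → Poly 𝕜 n} (hx : x ∈ wGr 𝕜 n w e) :
    compW w e x = x :=
  funext fun i => polyComp_of_mem (mem_wGr.1 hx i)

/-- Both sides are `𝕜`-linear in `x`, so it suffices to take a monomial times a basis vector; this
is homogeneous, and its component is either everything or zero. -/
theorem map_compW_of_graded [Finite ι] {w : ι → ℤ} {m : ℤ}
    {T : (ι → Poly 𝕜 n) →ₗ[Poly 𝕜 n] Poly 𝕜 n}
    (hT : ∀ e, ∀ x ∈ wGr 𝕜 n w e, T x ∈ polyGr 𝕜 n (e + m)) (e : ℤ) (x : ι → Poly 𝕜 n) :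
    T (compW w e x) = polyComp (e + m) (T x) := by
  classical
  have h : T.restrictScalars 𝕜 ∘ₗ compW w e = polyComp (e + m) ∘ₗ T.restrictScalars 𝕜 := by
    refine LinearMap.pi_ext' fun i => MvPolynomial.linearMap_ext fun s => LinearMap.ext fun r => ?_
    change T (compW w e (Pi.single i (monomial s r))) =
      polyComp (e + m) (T (Pi.single i (monomial s r)))
    have hs : (monomial s r : Poly 𝕜 n) ∈ polyGr 𝕜 n s.degree :=
      mem_polyGr_of_isHomogeneous (isHomogeneous_monomial r rfl)
    have hx : Pi.single i (monomial s r) ∈ wGr 𝕜 n w (s.degree + w i) :=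
      single_mem_wGr i (by simpa using hs)
    by_cases he : (s.degree : ℤ) + w i = e
    · subst he
      rw [compW_of_mem hx, polyComp_of_mem (hT _ _ hx)]
    · rw [polyComp_of_mem_of_ne (hT _ _ hx) (by omega)]
      have h0 : compW w e (Pi.single i (monomial s r) : ι → Poly 𝕜 n) = 0 := by
        ext1 j
        rw [compW_apply]
        by_cases hj : j = i
        · subst hj
          rw [Pi.single_eq_same]
          exact polyComp_of_mem_of_ne hs (by omega)
        · rw [Pi.single_eq_of_ne hj, map_zero]; rfl
      rw [h0, map_zero]
  exact LinearMap.congr_fun h x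

/-- The linear map `T` between free modules with weights `w`, `w'` is graded of degree zero. -/
def IsWGraded (w : ι → ℤ) (w' : κ → ℤ) (T : (ι → Poly 𝕜 n) →ₗ[Poly 𝕜 n] (κ → Poly 𝕜 n)) : Prop :=
  ∀ e, ∀ x ∈ wGr 𝕜 n w e, T x ∈ wGr 𝕜 n w' e

theorem IsWGraded.map_compW [Finite ι] {w : ι → ℤ} {w' : κ → ℤ}
    {T : (ι → Poly 𝕜 n) →ₗ[Poly 𝕜 n] (κ → Poly 𝕜 n)} (hT : IsWGraded w w' T) (e : ℤ)
    (x : ι → Poly 𝕜 n) : T (compW w e x) = compW w' e (T x) := by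
  ext1 k
  have h := map_compW_of_graded (w := w) (m := -w' k) (T := LinearMap.proj k ∘ₗ T)
    (fun e x hx => by
      have := mem_wGr.1 (hT e x hx) k
      rwa [sub_eq_add_neg] at this) e x
  rw [compW_apply, sub_eq_add_neg]
  exact h

/-- `x` and its component of degree `e` have the same image. It yields gradedness of maps obtained
by factoring through an injection. -/
theorem IsWGraded.mem_of_injective [Finite ι] {w : ι → ℤ} {w' : κ → ℤ}
    {T : (ι → Poly 𝕜 n) →ₗ[Poly 𝕜 n] (κ → Poly 𝕜 n)} (hT : IsWGraded w w' T)
    (hi : Function.Injective T) {e : ℤ} {x : ι → Poly 𝕜 n} (hx : T x ∈ wGr 𝕜 n w' e) :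
    x ∈ wGr 𝕜 n w e := by
  have h : compW w e x = x := hi (by rw [hT.map_compW, compW_of_mem hx])
  rw [← h]
  exact compW_mem _ _ _

theorem IsWGraded.comp {w : ι → ℤ} {w' : κ → ℤ} {w'' : μ → ℤ}
    {U : (κ → Poly 𝕜 n) →ₗ[Poly 𝕜 n] (μ → Poly 𝕜 n)}
    {T : (ι → Poly 𝕜 n) →ₗ[Poly 𝕜 n] (κ → Poly 𝕜 n)} (hU : IsWGraded w' w'' U)
    (hT : IsWGraded w w' T) : IsWGraded w w'' (U ∘ₗ T) :=
  fun e x hx => hU e _ (hT e x hx)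

theorem isWGraded_of_single [Fintype ι] [DecidableEq ι] {w : ι → ℤ} {w' : κ → ℤ}
    {T : (ι → Poly 𝕜 n) →ₗ[Poly 𝕜 n] (κ → Poly 𝕜 n)}
    (hT : ∀ i, T (Pi.single i 1) ∈ wGr 𝕜 n w' (w i)) : IsWGraded w w' T := by
  intro e x hx
  rw [pi_eq_sum_univ' x, map_sum]
  refine Submodule.sum_mem _ fun i _ => ?_
  rw [map_smul]
  have h := smul_mem_wGr (mem_wGr.1 hx i) (hT i)
  rwa [sub_add_cancel] at h

theorem isWGraded_kosD (k : ℕ) (D : ℤ) :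
    IsWGraded (𝕜 := 𝕜) (fun _ => D) (fun _ => D - 1) (kosD 𝕜 n k) := by
  intro e x hx
  rw [mem_wGr] at hx ⊢
  intro I
  rw [kosD_apply]
  refine Submodule.sum_mem _ fun i _ => ?_
  split_ifs with h
  · rw [mul_assoc]
    refine neg_one_pow_mul_mem_polyGr _ ?_
    have h1 := mul_mem_polyGr (X_mem_polyGr i) (hx ⟨_, h⟩)
    rwa [show 1 + (e - D) = e - (D - 1) by ring] at h1
  · exact zero_mem _

/-- A graded map from a free module to a syzygy module lifts to a graded map to the Koszul
module. -/
theorem exists_graded_lift {q k : ℕ} {b : Fin q → ℤ} {D : ℤ}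
    (h : (Fin q → Poly 𝕜 n) →ₗ[Poly 𝕜 n] Syz 𝕜 n k)
    (hh : IsWGraded b (fun _ => D - 1) ((Syz 𝕜 n k).subtype ∘ₗ h)) :
    ∃ β : (Fin q → Poly 𝕜 n) →ₗ[Poly 𝕜 n] Kos 𝕜 n k, IsWGraded b (fun _ => D) β ∧
      toSyz 𝕜 n k ∘ₗ β = h := by
  have hex : ∀ i, ∃ y : Kos 𝕜 n k, y ∈ wGr 𝕜 n (fun _ => D) (b i) ∧
      toSyz 𝕜 n k y = h (Pi.single i 1) := by
    intro i
    obtain ⟨y, hy⟩ := toSyz_surjective k (h (Pi.single i 1))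
    -- The component of the right degree of an arbitrary preimage is again a preimage, because `∂_k`
    -- commutes with components.
    refine ⟨compW (fun _ => D) (b i) y, compW_mem _ _ _, Subtype.ext ?_⟩
    have h1 : (h (Pi.single i 1)).1 ∈ wGr 𝕜 n (fun _ => D - 1) (b i) :=
      hh _ _ (single_mem_wGr i (by rw [sub_self]; exact one_mem_polyGr))
    rw [coe_toSyz, (isWGraded_kosD k D).map_compW, ← coe_toSyz, hy, compW_of_mem h1]
  choose y hy1 hy2 using hex
  refine ⟨Fintype.linearCombination (Poly 𝕜 n) y, ?_, ?_⟩
  · refine isWGraded_of_single fun i => ?_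
    simpa using hy1 i
  · refine LinearMap.pi_ext' fun i => LinearMap.ext_ring ?_
    simp [hy2]

end WeightedGradings

/-! ### Splitting a free module off a graded free module -/

section Splitting

variable {𝕜 : Type*} [Field 𝕜] {n : ℕ}

/-- A graded split surjection `π` onto a free module with generators in one degree maps a part
of the standard basis to a basis. -/
theorem exists_graded_section_of_subbasis {q : ℕ} {b : Fin q → ℤ} {ι : Type*} [Fintype ι] {D : ℤ}
    {π : (Fin q → Poly 𝕜 n) →ₗ[Poly 𝕜 n] (ι → Poly 𝕜 n)}
    {s : (ι → Poly 𝕜 n) →ₗ[Poly 𝕜 n] (Fin q → Poly 𝕜 n)}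
    (hπ : IsWGraded b (fun _ => D) π) (hπs : ∀ k, π (s k) = k) :
    ∃ (T : Set (Fin q)) (ρ : (ι → Poly 𝕜 n) →ₗ[Poly 𝕜 n] (Fin q → Poly 𝕜 n)),
      IsWGraded (fun _ => D) b ρ ∧ (∀ k, π (ρ k) = k) ∧ (∀ k, ∀ i ∉ T, ρ k i = 0) ∧
      ∀ i ∈ T, ρ (π (Pi.single i 1)) = Pi.single i 1 := by
  classical
  -- The matrix of `π` modulo `𝔪`. The section `s` makes it surjective, so some of its columns form
  -- a basis of the target over `𝕜`.
  let c : Fin q → ι → 𝕜 := fun i I => constantCoeff (π (Pi.single i 1) I)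
  obtain ⟨κ, a, ha, hsp, hli⟩ := exists_linearIndependent' 𝕜 c
  have hfin : Finite κ := Finite.of_injective a ha
  have := Fintype.ofFinite κ
  have htop : ⊤ ≤ Submodule.span 𝕜 (Set.range (c ∘ a)) := by
    rw [hsp]
    have h1 : ∀ I : ι, (Pi.single I 1 : ι → 𝕜) ∈ Submodule.span 𝕜 (Set.range c) := by
      intro I
      have h2 : (Pi.single I 1 : ι → 𝕜) =
          ∑ i, constantCoeff (s (Pi.single I 1) i) • c i := by
        ext1 J
        have h3 := congrArg constantCoeff (congrFun (hπs (Pi.single I 1)) J)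
        rw [pi_eq_sum_univ' (s (Pi.single I 1)), map_sum, Finset.sum_apply, map_sum] at h3
        simp only [map_smul, Pi.smul_apply, smul_eq_mul, map_mul] at h3
        rw [Finset.sum_apply]
        simp only [Pi.smul_apply, smul_eq_mul, c]
        rw [h3, Pi.single_apply, Pi.single_apply]
        split_ifs <;> simp
      rw [h2]
      exact Submodule.sum_mem _ fun i _ => Submodule.smul_mem _ _ (Submodule.subset_span ⟨i, rfl⟩)
    intro x _
    rw [pi_eq_sum_univ' x]
    exact Submodule.sum_mem _ fun I _ => Submodule.smul_mem _ _ (h1 I)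
  let B := Module.Basis.mk hli htop
  have hB : ∀ k, B k = c (a k) := fun k => Module.Basis.mk_apply hli htop k
  have hgr : ∀ i J, π (Pi.single i 1) J ∈ polyGr 𝕜 n (b i - D) := fun i J =>
    mem_wGr.1 (hπ _ _ (single_mem_wGr i (by rw [sub_self]; exact one_mem_polyGr))) J
  -- A selected column has an entry with nonzero constant term, which forces its degree; then all
  -- its entries are constants and the selected block is inverted over `𝕜`.
  have hbD : ∀ k, b (a k) = D := by
    intro k
    obtain ⟨I, hI⟩ := Function.ne_iff.1 (hli.ne_zero k)
    have := eq_zero_of_constantCoeff_ne_zero (hgr (a k) I) hI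
    omega
  have hconst : ∀ k, π (Pi.single (a k) 1) = fun I => C (c (a k) I) := by
    intro k
    ext1 I
    refine eq_C_of_mem_polyGr_zero ?_
    have := hgr (a k) I
    rwa [hbD, sub_self] at this
  let ρ : (ι → Poly 𝕜 n) →ₗ[Poly 𝕜 n] (Fin q → Poly 𝕜 n) :=
    Fintype.linearCombination (Poly 𝕜 n) fun I =>
      ∑ k, (C (B.repr (Pi.single I 1) k) : Poly 𝕜 n) • Pi.single (a k) 1
  have hρ1 : ∀ I, ρ (Pi.single I 1) =
      ∑ k, (C (B.repr (Pi.single I 1) k) : Poly 𝕜 n) • Pi.single (a k) 1 := fun I => by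
    simp [ρ]
  have hρC : ∀ x : ι → 𝕜, ρ (fun I => C (x I)) =
      ∑ k, (C (B.repr x k) : Poly 𝕜 n) • Pi.single (a k) 1 := by
    intro x
    have h1 : ∀ k, B.repr x k = ∑ I, x I * B.repr (Pi.single I 1) k := by
      intro k
      conv_lhs => rw [pi_eq_sum_univ' x]
      simp [Finsupp.finsetSum_apply]
    rw [Fintype.linearCombination_apply]
    simp only [h1, map_sum, map_mul, Finset.smul_sum, smul_smul, Finset.sum_smul]
    exact Finset.sum_comm
  have hπC : ∀ x : ι → 𝕜, π (∑ k, (C (B.repr x k) : Poly 𝕜 n) • Pi.single (a k) 1) =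
      fun I => C (x I) := by
    intro x
    rw [map_sum]
    simp only [map_smul, hconst]
    ext1 I
    conv_rhs => rw [← B.sum_repr x]
    simp only [Finset.sum_apply, Pi.smul_apply, smul_eq_mul, hB, map_sum, map_mul]
  refine ⟨Set.range a, ρ, ?_, ?_, ?_, ?_⟩
  · refine isWGraded_of_single fun I => ?_
    rw [hρ1]
    refine Submodule.sum_mem _ fun k _ => ?_
    have h1 : (Pi.single (a k) 1 : Fin q → Poly 𝕜 n) ∈ wGr 𝕜 n b D :=
      single_mem_wGr _ (by rw [hbD, sub_self]; exact one_mem_polyGr)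
    have h2 := smul_mem_wGr (C_mem_polyGr (B.repr (Pi.single I 1) k)) h1
    rwa [zero_add] at h2
  · intro x
    have h1 : π ∘ₗ ρ = LinearMap.id := by
      refine LinearMap.pi_ext' fun I => LinearMap.ext_ring ?_
      simp only [LinearMap.comp_apply, LinearMap.single_apply, LinearMap.id_apply]
      rw [hρ1, hπC]
      ext1 J
      rw [Pi.single_apply, Pi.single_apply]
      split_ifs <;> simp
    exact LinearMap.congr_fun h1 x
  · intro x i hi
    simp only [ρ, Fintype.linearCombination_apply, Finset.sum_apply, Pi.smul_apply]
    refine Finset.sum_eq_zero fun I _ => ?_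
    rw [Finset.sum_eq_zero, smul_zero]
    intro k _
    rw [Pi.single_eq_of_ne, smul_zero]
    rintro rfl
    exact hi ⟨k, rfl⟩
  · rintro _ ⟨k, rfl⟩
    rw [hconst, hρC, ← hB, B.repr_self, Finset.sum_eq_single k]
    · simp
    · intro k' _ hk'
      rw [Finsupp.single_eq_of_ne hk', map_zero, zero_smul]
    · simp

/-- A free module with a graded split surjection `π` onto a free module with generators in one
degree is the direct sum of this module and of a graded free module. -/
theorem exists_graded_splitting {q : ℕ} {b : Fin q → ℤ} {ι : Type*} [Fintype ι] {D : ℤ}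
    {π : (Fin q → Poly 𝕜 n) →ₗ[Poly 𝕜 n] (ι → Poly 𝕜 n)}
    {s : (ι → Poly 𝕜 n) →ₗ[Poly 𝕜 n] (Fin q → Poly 𝕜 n)}
    (hπ : IsWGraded b (fun _ => D) π) (hs : IsWGraded (fun _ => D) b s)
    (hπs : ∀ k, π (s k) = k) :
    ∃ (q' : ℕ) (b' : Fin q' → ℤ)
      (v : (Fin q → Poly 𝕜 n) ≃ₗ[Poly 𝕜 n] (Fin q' → Poly 𝕜 n) × (ι → Poly 𝕜 n)),
      IsWGraded b b' (LinearMap.fst _ _ _ ∘ₗ v.toLinearMap) ∧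
      IsWGraded b' b (v.symm.toLinearMap ∘ₗ LinearMap.inl _ _ _) ∧
      (∀ y, (v y).2 = π y) ∧ ∀ k, v (s k) = (0, k) := by
  classical
  obtain ⟨T, ρ, hρ, hπρ, hρT, hTρ⟩ := exists_graded_section_of_subbasis hπ hπs
  let e : {i // i ∉ T} ≃ Fin (Fintype.card {i // i ∉ T}) := Fintype.equivFin _
  let res : (Fin q → Poly 𝕜 n) →ₗ[Poly 𝕜 n] (Fin (Fintype.card {i // i ∉ T}) → Poly 𝕜 n) :=
    LinearMap.pi fun j => LinearMap.proj (e.symm j).1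
  let ex : (Fin (Fintype.card {i // i ∉ T}) → Poly 𝕜 n) →ₗ[Poly 𝕜 n] (Fin q → Poly 𝕜 n) :=
    LinearMap.pi fun i => if h : i ∉ T then LinearMap.proj (e ⟨i, h⟩) else 0
  have hres : ∀ y j, res y j = y (e.symm j).1 := fun _ _ => rfl
  have hex : ∀ z i, ex z i = if h : i ∉ T then z (e ⟨i, h⟩) else 0 := by
    intro z i
    simp only [ex, LinearMap.pi_apply]
    split_ifs <;> rfl
  have hresex : ∀ z, res (ex z) = z := by
    intro z
    ext1 j
    rw [hres, hex, dif_pos (e.symm j).2, Subtype.coe_eta, Equiv.apply_symm_apply]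
  have hresρ : ∀ k, res (ρ k) = 0 := by
    intro k
    ext1 j
    rw [hres, hρT _ _ (e.symm j).2]
    rfl
  -- The element `y - ex (res y)` is supported on `T`, where `ρ ∘ π` fixes the basis vectors.
  have hρπ : ∀ y, ρ (π (y - ex (res y))) = y - ex (res y) := by
    intro y
    conv_lhs => rw [pi_eq_sum_univ' (y - ex (res y))]
    conv_rhs => rw [pi_eq_sum_univ' (y - ex (res y))]
    rw [map_sum, map_sum]
    refine Finset.sum_congr rfl fun i _ => ?_
    rw [map_smul, map_smul]
    by_cases hi : i ∈ T
    · rw [hTρ i hi]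
    · have h0 : (y - ex (res y)) i = 0 := by
        rw [Pi.sub_apply, hex, dif_pos hi, hres, Equiv.symm_apply_apply, sub_self]
      rw [h0, zero_smul, zero_smul]
  have hexg : IsWGraded (fun j => b (e.symm j).1) b ex := by
    intro d z hz
    rw [mem_wGr] at hz ⊢
    intro i
    rw [hex]
    split_ifs with h
    · exact zero_mem _
    · have := hz (e ⟨i, h⟩)
      rwa [Equiv.symm_apply_apply] at this
  have hresg : IsWGraded b (fun j => b (e.symm j).1) res := by
    intro d y hy
    rw [mem_wGr] at hy ⊢
    exact fun j => hy _
  -- The kernel of `π` is free on the coordinates outside `T`, through `z ↦ ex z - ρ (π (ex z))`.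
  -- The auxiliary section `ρ` only describes this kernel; its complement is the image of the
  -- prescribed section `s`.
  let v : (Fin q → Poly 𝕜 n) ≃ₗ[Poly 𝕜 n]
      (Fin (Fintype.card {i // i ∉ T}) → Poly 𝕜 n) × (ι → Poly 𝕜 n) :=
    LinearEquiv.ofLinearMap ((res ∘ₗ (LinearMap.id - s ∘ₗ π)).prod π)
      ((ex - ρ ∘ₗ π ∘ₗ ex).coprod s)
      (LinearMap.ext fun x => by
        have h1 : π (ex x.1 - ρ (π (ex x.1)) + s x.2) = x.2 := by
          rw [map_add, map_sub, hπρ, hπs, sub_self, zero_add]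
        refine Prod.ext ?_ h1
        change res (ex x.1 - ρ (π (ex x.1)) + s x.2 -
          s (π (ex x.1 - ρ (π (ex x.1)) + s x.2))) = x.1
        rw [h1, add_sub_cancel_right, map_sub, hresex, hresρ, sub_zero])
      (LinearMap.ext fun y => by
        change ex (res (y - s (π y))) - ρ (π (ex (res (y - s (π y))))) + s (π y) = y
        have h1 := hρπ (y - s (π y))
        have h2 : π (y - s (π y)) = 0 := by rw [map_sub, hπs, sub_self]
        rw [map_sub, map_sub, h2, map_zero, zero_sub] at h1
        rw [sub_eq_add_neg (ex _), h1]
        abel)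
  refine ⟨_, fun j => b (e.symm j).1, v, ?_, ?_, fun _ => rfl, ?_⟩
  · intro d y hy
    exact hresg _ _ (Submodule.sub_mem _ hy (hs _ _ (hπ _ _ hy)))
  · intro d z hz
    change ex z - ρ (π (ex z)) + s 0 ∈ _
    rw [map_zero, add_zero]
    exact Submodule.sub_mem _ (hexg _ _ hz) (hρ _ _ (hπ _ _ (hexg _ _ hz)))
  · intro k
    change (res (s k - s (π (s k))), π (s k)) = (0, k)
    rw [hπs, sub_self, map_zero]

end Splitting

/-! ### Long Bourbaki sequences correspond to admissible choices -/

section ConstructionData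

variable {𝕜 : Type*} [Field 𝕜] {n : ℕ}

theorem isGradedHom_zero_iff {M N : Type*} [AddCommGroup M] [Module 𝕜 M] [AddCommGroup N]
    [Module 𝕜 N] {grM : ℤ → Submodule 𝕜 M} {grN : ℤ → Submodule 𝕜 N} {f : M → N} :
    IsGradedHom 0 grM grN f ↔ ∀ e, ∀ x ∈ grM e, f x ∈ grN e := by
  simp [IsGradedHom]

theorem mem_prodGr {M N : Type*} [AddCommGroup M] [Module 𝕜 M] [AddCommGroup N]
    [Module 𝕜 N] {grM : ℤ → Submodule 𝕜 M} {grN : ℤ → Submodule 𝕜 N} {e : ℤ} {x : M × N} :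
    x ∈ prodGr grM grN e ↔ x.1 ∈ grM e ∧ x.2 ∈ grN e := Iff.rfl

theorem mem_shift_syzGr {k : ℕ} (hk : 1 ≤ k) {d e : ℤ} {x : Syz 𝕜 n k} :
    x ∈ shift (syzGr 𝕜 n k) d e ↔ x.1 ∈ wGr 𝕜 n (fun _ => (k : ℤ) - d - 1) e := by
  have h : x ∈ shift (syzGr 𝕜 n k) d e ↔ x.1 ∈ shift (kosGr 𝕜 n (k - 1)) d e := Iff.rfl
  rw [h, shift_kosGr_eq, Nat.cast_sub hk, Nat.cast_one,
    show (k : ℤ) - 1 - d = k - d - 1 by ring]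

theorem mem_syzGr {k : ℕ} (hk : 1 ≤ k) {e : ℤ} {x : Syz 𝕜 n k} :
    x ∈ syzGr 𝕜 n k e ↔ x.1 ∈ wGr 𝕜 n (fun _ => (k : ℤ) - 1) e := by
  have h := mem_shift_syzGr (𝕜 := 𝕜) (n := n) hk (d := 0) (e := e) (x := x)
  rwa [shift, zero_add, sub_zero] at h

theorem mem_kkGr {t : ℕ} {d e : ℤ} {x : KK 𝕜 n t} :
    x ∈ kkGr 𝕜 n t d e ↔ x.1 ∈ wGr 𝕜 n (fun _ => ((t + 1 : ℕ) : ℤ)) e ∧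
      x.2 ∈ wGr 𝕜 n (fun _ => ((n - 1 : ℕ) : ℤ) - d) e := by
  rw [kkGr, mem_prodGr, kosGr_eq, shift_kosGr_eq]

theorem mem_eeGr {t : ℕ} (hn : 2 ≤ n) {d e : ℤ} {x : EE 𝕜 n t} :
    x ∈ eeGr 𝕜 n t d e ↔ x.1.1 ∈ wGr 𝕜 n (fun _ => ((t + 1 : ℕ) : ℤ) - 1) e ∧
      x.2.1 ∈ wGr 𝕜 n (fun _ => ((n - 1 : ℕ) : ℤ) - d - 1) e := by
  rw [eeGr, mem_prodGr, mem_syzGr (by omega), mem_shift_syzGr (by omega)]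

theorem dBar_apply {t : ℕ} (x : KK 𝕜 n t) :
    dBar 𝕜 n t x = (toSyz 𝕜 n (t + 1) x.1, toSyz 𝕜 n (n - 1) x.2) := rfl

theorem dBar_surjective (t : ℕ) : Function.Surjective (dBar 𝕜 n t) := by
  rintro ⟨x, y⟩
  obtain ⟨x, rfl⟩ := toSyz_surjective _ x
  obtain ⟨y, rfl⟩ := toSyz_surjective _ y
  exact ⟨(x, y), rfl⟩

/-- Koszul exactness at `K_{t+1}` and `K_{n-1}`. Through it the conditions on `β` and `ψ` become
statements about `g` and `φ`. -/
theorem mem_syzSub_iff {t : ℕ} (hn : 2 ≤ n) {x : KK 𝕜 n t} :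
    x ∈ syzSub 𝕜 n t ↔ dBar 𝕜 n t x = 0 := by
  rw [syzSub, Submodule.mem_prod, dBar_apply, Prod.mk_eq_zero, toSyz_eq_zero, toSyz_eq_zero]
  exact and_congr mem_syz_add_two_iff (mem_syz_iff hn)

variable {t p q : ℕ} {c d : ℤ} {a : Fin p → ℤ} {b : Fin q → ℤ}
  {f : (Fin p → Poly 𝕜 n) →ₗ[Poly 𝕜 n] (Fin q → Poly 𝕜 n)}
  {g : (Fin q → Poly 𝕜 n) →ₗ[Poly 𝕜 n] EE 𝕜 n t}
  {φ : EE 𝕜 n t →ₗ[Poly 𝕜 n] Poly 𝕜 n} {I : Ideal (Poly 𝕜 n)}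

theorem range_betaMap (β : Fin q → KK 𝕜 n t) : LinearMap.range (betaMap β) = spanBeta β :=
  Fintype.range_linearCombination _ _

theorem betaMap_single (β : Fin q → KK 𝕜 n t) (i : Fin q) : betaMap β (Pi.single i 1) = β i := by
  simp [betaMap]

theorem betaMap_apply_single (β : (Fin q → Poly 𝕜 n) →ₗ[Poly 𝕜 n] KK 𝕜 n t) :
    betaMap (fun i => β (Pi.single i 1)) = β :=
  LinearMap.pi_ext' fun _ => LinearMap.ext_ring (betaMap_single _ _)

theorem exists_lift_dBar (hn : 2 ≤ n)
    (hg : IsGradedHom 0 (freeGr 𝕜 n b) (eeGr 𝕜 n t d) g) :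
    ∃ β : (Fin q → Poly 𝕜 n) →ₗ[Poly 𝕜 n] KK 𝕜 n t,
      (∀ i, β (Pi.single i 1) ∈ kkGr 𝕜 n t d (b i)) ∧ dBar 𝕜 n t ∘ₗ β = g := by
  rw [isGradedHom_zero_iff, freeGr_eq] at hg
  obtain ⟨β₁, h1, h1'⟩ := exists_graded_lift (b := b) (D := ((t + 1 : ℕ) : ℤ))
    (LinearMap.fst _ _ _ ∘ₗ g) fun e x hx => ((mem_eeGr hn).1 (hg e x hx)).1
  obtain ⟨β₂, h2, h2'⟩ := exists_graded_lift (b := b) (D := ((n - 1 : ℕ) : ℤ) - d)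
    (LinearMap.snd _ _ _ ∘ₗ g) fun e x hx => ((mem_eeGr hn).1 (hg e x hx)).2
  refine ⟨β₁.prod β₂, fun i => ?_, LinearMap.ext fun y => ?_⟩
  · have hi : (Pi.single i 1 : Fin q → Poly 𝕜 n) ∈ wGr 𝕜 n b (b i) :=
      single_mem_wGr i (by rw [sub_self]; exact one_mem_polyGr)
    exact mem_kkGr.2 ⟨h1 _ _ hi, h2 _ _ hi⟩
  · exact Prod.ext (LinearMap.congr_fun h1' y) (LinearMap.congr_fun h2' y)

/-- Every homogeneous lift `β` of `g` is admissible, with `ψ = φ ∘ dBar`; this freedom is used later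
to choose a lift adapted to a splitting. Exactness at `E_{t+1} ⊕ E_{n-1}` gives the kernel of `ψ`,
and exactness at `G` gives the two conditions on `f`. -/
theorem IsLongBourbaki.isConstructionOf (hn : t + 4 ≤ n) (h : IsLongBourbaki t c d a b f g φ I)
    (hg0 : ∀ i, g (Pi.single i 1) ≠ 0) {β : (Fin q → Poly 𝕜 n) →ₗ[Poly 𝕜 n] KK 𝕜 n t}
    (hβ : ∀ i, β (Pi.single i 1) ∈ kkGr 𝕜 n t d (b i)) (hβg : dBar 𝕜 n t ∘ₗ β = g) :
    IsConstructionOf t c d a b f g φ I (fun i => β (Pi.single i 1))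
      (φ ∘ₗ dBar 𝕜 n t ∘ₗ LinearMap.inl _ _ _) (φ ∘ₗ dBar 𝕜 n t ∘ₗ LinearMap.inr _ _ _) := by
  have hψ : (φ ∘ₗ dBar 𝕜 n t ∘ₗ LinearMap.inl _ _ _).coprod
      (φ ∘ₗ dBar 𝕜 n t ∘ₗ LinearMap.inr _ _ _) = φ ∘ₗ dBar 𝕜 n t := by
    rw [← LinearMap.comp_assoc, ← LinearMap.comp_assoc, ← LinearMap.comp_coprod,
      LinearMap.coprod_inl_inr, LinearMap.comp_id]
  have hβg' : ∀ y, dBar 𝕜 n t (β y) = g y := LinearMap.congr_fun hβg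
  have hrange : LinearMap.range (φ ∘ₗ dBar 𝕜 n t) = I := by
    rw [LinearMap.range_comp_of_range_eq_top _ (LinearMap.range_eq_top.2 (dBar_surjective t)),
      h.range_phi]
  refine ⟨?_, by rw [betaMap_apply_single, hβg], hψ.symm, by rw [hψ, hrange]⟩
  constructor
  · exact hβ
  · intro i hi
    rw [mem_syzSub_iff (by omega), hβg'] at hi
    exact hg0 i hi
  · refine mem_calA (by omega) fun y => ?_
    have h1 : toSyz 𝕜 n (t + 1) (kosD 𝕜 n (t + 2) y) = 0 :=
      toSyz_eq_zero.2 (kosD_kosD (k := t + 2) (by omega) y)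
    change φ (toSyz 𝕜 n (t + 1) (kosD 𝕜 n (t + 2) y), toSyz 𝕜 n (n - 1) 0) = 0
    rw [h1, map_zero]
    exact map_zero φ
  · refine mem_calB (by omega) fun y => ?_
    have h1 : toSyz 𝕜 n (n - 1) (kosD 𝕜 n n y) = 0 :=
      toSyz_eq_zero.2 (kosD_kosD (by omega) y)
    change φ (toSyz 𝕜 n (t + 1) 0, toSyz 𝕜 n (n - 1) (kosD 𝕜 n n y)) = 0
    rw [h1, map_zero]
    exact map_zero φ
  · rw [hψ]
    intro e x hx
    rw [mem_kkGr] at hx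
    have h1 : dBar 𝕜 n t x ∈ eeGr 𝕜 n t d e :=
      (mem_eeGr (by omega)).2 ⟨isWGraded_kosD _ _ _ _ hx.1, isWGraded_kosD _ _ _ _ hx.2⟩
    have h2 := h.graded_phi e _ h1
    rw [LinearMap.comp_apply]
    unfold shift at h2 ⊢
    rwa [show c + (e + 0) = -(n : ℤ) + (e + (n + c)) by ring] at h2
  · rw [hψ, ← range_betaMap, betaMap_apply_single]
    ext x
    rw [LinearMap.mem_ker, LinearMap.comp_apply, Submodule.mem_sup]
    constructor
    · intro hx
      obtain ⟨y, hy⟩ := (h.exact_phi _).1 hx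
      refine ⟨β y, ⟨y, rfl⟩, x - β y, ?_, add_sub_cancel _ _⟩
      rw [mem_syzSub_iff (by omega), map_sub, hβg', hy, sub_self]
    · rintro ⟨_, ⟨y, rfl⟩, z, hz, rfl⟩
      rw [mem_syzSub_iff (by omega)] at hz
      rw [map_add, hz, add_zero, hβg']
      exact (h.exact_phi _).2 ⟨y, rfl⟩
  · exact rank_formula hn h.injective h.exact_g h.exact_phi
  · exact h.graded_f
  · exact h.injective
  · rw [← range_betaMap, betaMap_apply_single]
    ext x
    constructor
    · rintro ⟨y, rfl⟩
      refine ⟨⟨f y, rfl⟩, (mem_syzSub_iff (by omega)).2 ?_⟩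
      rw [LinearMap.comp_apply, hβg']
      exact (h.exact_g _).2 ⟨y, rfl⟩
    · rintro ⟨⟨y, rfl⟩, hy⟩
      have hy' := (mem_syzSub_iff (by omega)).1 hy
      rw [hβg'] at hy'
      obtain ⟨z, rfl⟩ := (h.exact_g _).1 hy'
      exact ⟨z, rfl⟩
  · rw [betaMap_apply_single]
    ext y
    constructor
    · rintro ⟨z, hz, rfl⟩
      exact hz
    · intro hy
      have hy' : g y = 0 := by rw [← hβg', LinearMap.mem_ker.1 hy, map_zero]
      obtain ⟨z, rfl⟩ := (h.exact_g _).1 hy'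
      exact ⟨z, hy, rfl⟩

/-- If `g y = 0`, then `β y` lies in `N ∩ (E_{t+2} ⊕ E_n)` and equals some `β (f z)`; the difference
`y - f z` is in `Ker β`, hence also in `Im f`. The ideal is graded because `ψ` commutes with
homogeneous components. -/
theorem IsConstructionOf.isLongBourbaki (hn : 2 ≤ n) {β : Fin q → KK 𝕜 n t}
    {ψ₁ : Kos 𝕜 n (t + 1) →ₗ[Poly 𝕜 n] Poly 𝕜 n} {ψ₂ : Kos 𝕜 n (n - 1) →ₗ[Poly 𝕜 n] Poly 𝕜 n}
    (h : IsConstructionOf t c d a b f g φ I β ψ₁ ψ₂)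
    (hg : IsGradedHom 0 (freeGr 𝕜 n b) (eeGr 𝕜 n t d) g)
    (hφ : IsGradedHom 0 (eeGr 𝕜 n t d) (shift (polyGr 𝕜 n) c) φ) :
    IsLongBourbaki t c d a b f g φ I := by
  have hg' : ∀ y, dBar 𝕜 n t (betaMap β y) = g y := LinearMap.congr_fun h.lifts
  have hφ' : ∀ x, φ (dBar 𝕜 n t x) = ψ₁.coprod ψ₂ x := LinearMap.congr_fun h.comp_phi
  have hdeg : ∀ e, ∀ x ∈ kkGr 𝕜 n t d e, ψ₁.coprod ψ₂ x ∈ polyGr 𝕜 n (e + c) := by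
    intro e x hx
    have h1 := h.datum.degree_psi e x hx
    unfold shift at h1
    rwa [show -(n : ℤ) + (e + (n + c)) = e + c by ring] at h1
  refine ⟨h.datum.graded_f, hg, hφ, ?_, h.datum.injective_f, ?_, ?_, ?_⟩
  · intro x hx k
    rw [← h.range_psi] at hx ⊢
    obtain ⟨⟨y₁, y₂⟩, rfl⟩ := hx
    have h1 := map_compW_of_graded (w := fun _ => ((t + 1 : ℕ) : ℤ)) (m := c) (T := ψ₁)
      (fun e y hy => by
        simpa using hdeg e (y, 0) (mem_kkGr.2 ⟨hy, Submodule.zero_mem _⟩)) (k - c) y₁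
    have h2 := map_compW_of_graded (w := fun _ => ((n - 1 : ℕ) : ℤ) - d) (m := c) (T := ψ₂)
      (fun e y hy => by
        simpa using hdeg e (0, y) (mem_kkGr.2 ⟨Submodule.zero_mem _, hy⟩)) (k - c) y₂
    have h3 : polyComp (𝕜 := 𝕜) (n := n) (k - c + c) = homogeneousComponent k := by
      rw [sub_add_cancel, polyComp, if_pos (by omega), Int.toNat_natCast]
    refine ⟨(compW (fun _ => ((t + 1 : ℕ) : ℤ)) (k - c) y₁,
      compW (fun _ => ((n - 1 : ℕ) : ℤ) - d) (k - c) y₂), ?_⟩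
    rw [LinearMap.coprod_apply, h1, h2, h3, LinearMap.coprod_apply, map_add]
  · intro y
    rw [← hg', ← mem_syzSub_iff hn]
    constructor
    · intro hy
      have h1 : betaMap β y ∈ spanBeta β ⊓ syzSub 𝕜 n t :=
        ⟨by rw [← range_betaMap]; exact ⟨y, rfl⟩, hy⟩
      rw [← h.datum.range_res] at h1
      obtain ⟨z, hz⟩ := h1
      have h2 : y - f z ∈ LinearMap.ker (betaMap β) := by
        rw [LinearMap.mem_ker, map_sub, sub_eq_zero]
        exact hz.symm
      rw [← h.datum.ker_res] at h2
      obtain ⟨z', -, hz'⟩ := h2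
      exact ⟨z' + z, by rw [map_add, hz', sub_add_cancel]⟩
    · rintro ⟨z, rfl⟩
      have h1 : betaMap β (f z) ∈ spanBeta β ⊓ syzSub 𝕜 n t := by
        rw [← h.datum.range_res]; exact ⟨z, rfl⟩
      exact h1.2
  · intro x
    obtain ⟨x, rfl⟩ := dBar_surjective t x
    rw [hφ', ← LinearMap.mem_ker, h.datum.ker_psi, Submodule.mem_sup]
    constructor
    · rintro ⟨y, hy, z, hz, rfl⟩
      rw [← range_betaMap] at hy
      obtain ⟨y, rfl⟩ := hy
      exact ⟨y, by rw [map_add, (mem_syzSub_iff hn).1 hz, add_zero, hg']⟩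
    · rintro ⟨y, hy⟩
      refine ⟨betaMap β y, by rw [← range_betaMap]; exact ⟨y, rfl⟩, x - betaMap β y, ?_,
        add_sub_cancel _ _⟩
      rw [mem_syzSub_iff hn, map_sub, hg', hy, sub_self]
  · rw [← h.range_psi, ← h.comp_phi,
      LinearMap.range_comp_of_range_eq_top _ (LinearMap.range_eq_top.2 (dBar_surjective t))]

end ConstructionData

/-! ### Trivial type and decompositions of `N` -/

section TrivialType

variable {𝕜 : Type*} [Field 𝕜] {n : ℕ}

/-- An injective functional on `E_1` is multiplication by a polynomial. -/
theorem exists_range_eq_mul_of_syz_one (hn : 2 ≤ n) (φ : Syz 𝕜 n 1 →ₗ[Poly 𝕜 n] Poly 𝕜 n) :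
    ∃ h : Poly 𝕜 n, LinearMap.range φ = Ideal.span {h} * Ideal.span (Set.range X) := by
  classical
  obtain ⟨w, hw⟩ := exists_dual_coeff (j := 1) hn (ψ := φ ∘ₗ toSyz 𝕜 n 1) (fun y => by
    have h1 : toSyz 𝕜 n 1 (kosD 𝕜 n 2 y) = 0 := toSyz_eq_zero.2 (kosD_kosD le_rfl y)
    rw [LinearMap.comp_apply]
    exact (congrArg φ h1).trans (map_zero φ))
  -- Dual exactness at `K_1` leaves a single coefficient, at the empty set: it is the multiplier
  -- `h`.
  have hw' : ∀ i : Fin n, φ (toSyz 𝕜 n 1 (Pi.single ⟨{i}, Finset.card_singleton i⟩ 1)) =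
      w ∅ * X i := by
    intro i
    have h1 := hw ⟨{i}, Finset.card_singleton i⟩
    simp only [Finset.sum_singleton, Finset.erase_singleton, Finset.filter_empty,
      Finset.card_empty, pow_zero, one_mul] at h1
    rw [mul_comm, ← h1]
    rfl
  refine ⟨w ∅, le_antisymm ?_ ?_⟩
  · rintro _ ⟨y, rfl⟩
    obtain ⟨y, rfl⟩ := toSyz_surjective 1 y
    rw [pi_eq_sum_univ' y, map_sum, map_sum]
    refine Submodule.sum_mem _ fun J _ => ?_
    obtain ⟨J, hJ⟩ := J
    obtain ⟨i, rfl⟩ := Finset.card_eq_one.1 hJ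
    rw [map_smul, map_smul, hw']
    exact Submodule.smul_mem _ _ (Ideal.mul_mem_mul (Ideal.mem_span_singleton_self _)
      (Ideal.subset_span ⟨i, rfl⟩))
  · rw [Ideal.span_mul_span', Ideal.span_le]
    rintro _ ⟨_, rfl, _, ⟨i, rfl⟩, rfl⟩
    exact ⟨_, hw' i⟩

variable {t p q : ℕ} {c d : ℤ} {a : Fin p → ℤ} {b : Fin q → ℤ}
  {f : (Fin p → Poly 𝕜 n) →ₗ[Poly 𝕜 n] (Fin q → Poly 𝕜 n)}
  {g : (Fin q → Poly 𝕜 n) →ₗ[Poly 𝕜 n] EE 𝕜 n t}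
  {φ : EE 𝕜 n t →ₗ[Poly 𝕜 n] Poly 𝕜 n} {I : Ideal (Poly 𝕜 n)}

/-- For a sequence of trivial type, a suitable choice of the `β_i` spans a submodule
`A ⊕ K_{n-1}`. -/
theorem IsTrivialType.exists_decomposition (hn : t + 4 ≤ n)
    (hT : IsTrivialType t c d a b f g φ I) (h : IsLongBourbaki t c d a b f g φ I)
    (hg0 : ∀ i, g (Pi.single i 1) ≠ 0) :
    ∃ β ψ₁ ψ₂, IsConstructionOf t c d a b f g φ I β ψ₁ ψ₂ ∧
      ∃ A : Submodule (Poly 𝕜 n) (Kos 𝕜 n (t + 1)), spanBeta β = A.prod ⊤ ∧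
        ((1 ≤ t ∨ ∀ h : Poly 𝕜 n, I ≠ Ideal.span {h} * Ideal.span (Set.range X)) → A ≠ ⊥) := by
  obtain ⟨p', q', a', b', f', g', φ', u, v, -, hg', -, -, -, hgφ, hI, -, hv, -, hgv, -⟩ := hT
  rw [isGradedHom_zero_iff, freeGr_eq] at hg'
  rw [isGradedHom_zero_iff, freeGr_eq, freeGr_eq, shift_kosGr_eq] at hv
  obtain ⟨β', hβ', hβg'⟩ := exists_graded_lift (b := b') (D := ((t + 1 : ℕ) : ℤ)) g'
    fun e x hx => (mem_syzGr (by omega)).1 (hg' e x hx)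
  have hβg'' : ∀ y, toSyz 𝕜 n (t + 1) (β' y) = g' y := LinearMap.congr_fun hβg'
  -- Taking the identity on the summand `K_{n-1}` makes the second factor of `N` all of `K_{n-1}`.
  let β : (Fin q → Poly 𝕜 n) →ₗ[Poly 𝕜 n] KK 𝕜 n t :=
    β'.prodMap LinearMap.id ∘ₗ v.toLinearMap
  have hβ : ∀ i, β (Pi.single i 1) ∈ kkGr 𝕜 n t d (b i) := fun i => by
    have hi : (Pi.single i 1 : Fin q → Poly 𝕜 n) ∈ wGr 𝕜 n b (b i) :=
      single_mem_wGr i (by rw [sub_self]; exact one_mem_polyGr)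
    have h1 := hv _ _ hi
    exact mem_kkGr.2 ⟨hβ' _ _ h1.1, h1.2⟩
  have hβg : dBar 𝕜 n t ∘ₗ β = g := by
    rw [hgv]
    exact LinearMap.ext fun y => Prod.ext (hβg'' _) rfl
  refine ⟨_, _, _, h.isConstructionOf hn hg0 hβ hβg, LinearMap.range β', ?_, ?_⟩
  · rw [← range_betaMap, betaMap_apply_single]
    ext x
    constructor
    · rintro ⟨y, rfl⟩
      exact ⟨⟨_, rfl⟩, trivial⟩
    · rintro ⟨⟨z, hz⟩, -⟩
      refine ⟨v.symm (z, x.2), ?_⟩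
      change β'.prodMap LinearMap.id (v (v.symm (z, x.2))) = x
      rw [LinearEquiv.apply_symm_apply]
      exact Prod.ext hz rfl
  · intro hass hbot
    have hg0' : ∀ y, g' y = 0 := fun y => by
      rw [← hβg'', LinearMap.range_eq_bot.1 hbot, LinearMap.zero_apply, map_zero]
    have hinj : Function.Injective φ' := by
      rw [← LinearMap.ker_eq_bot, LinearMap.ker_eq_bot']
      intro x hx
      obtain ⟨y, rfl⟩ := (hgφ x).1 hx
      exact hg0' y
    -- If `A = 0`, then `φ'` is injective and `E_{t+1}` has rank at most one, which leaves only `t =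
    -- 0`.
    have hrank : (n - 1).choose t ≤ 1 := by
      have h1 := finrank_syz (𝕜 := 𝕜) (n := n) (k := t + 1) (by omega) (by omega)
      rw [← LinearMap.finrank_range_of_inj hinj] at h1
      refine h1.symm.le.trans ((Submodule.finrank_le _).trans ?_)
      rw [Module.finrank_self]
    have ht : t = 0 := by
      have h1 : (n - 1).choose t = 1 :=
        le_antisymm hrank (Nat.choose_pos (by omega))
      rcases Nat.choose_eq_one_iff.1 h1 with h2 | h2 <;> omega
    subst ht
    rcases hass with h1 | h1
    · omega
    · obtain ⟨r, hr⟩ := exists_range_eq_mul_of_syz_one (by omega) φ'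
      exact h1 r (by rw [← hI, hr])

/-- If `N` is the direct sum of submodules of the two summands, then `ψ₂` vanishes. -/
theorem IsConstructionOf.psi_snd_eq_zero (hn : t + 4 ≤ n) {β : Fin q → KK 𝕜 n t}
    {ψ₁ : Kos 𝕜 n (t + 1) →ₗ[Poly 𝕜 n] Poly 𝕜 n} {ψ₂ : Kos 𝕜 n (n - 1) →ₗ[Poly 𝕜 n] Poly 𝕜 n}
    (h : IsConstructionOf t c d a b f g φ I β ψ₁ ψ₂) (hLB : IsLongBourbaki t c d a b f g φ I)
    {A : Submodule (Poly 𝕜 n) (Kos 𝕜 n (t + 1))} {B : Submodule (Poly 𝕜 n) (Kos 𝕜 n (n - 1))}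
    (hAB : spanBeta β = A.prod B) : ψ₂ = 0 := by
  obtain ⟨x, hx⟩ := exists_phi_inl_ne_zero (by omega) hLB.injective hLB.exact_g hLB.exact_phi
  obtain ⟨y₁, rfl⟩ := toSyz_surjective _ x
  have h1 : φ (toSyz 𝕜 n (t + 1) y₁, 0) = ψ₁ y₁ := by
    have h2 := LinearMap.congr_fun h.comp_phi (y₁, 0)
    rw [LinearMap.comp_apply, dBar_apply, LinearMap.coprod_apply, map_zero, map_zero,
      add_zero] at h2
    exact h2
  rw [h1] at hx
  refine LinearMap.ext fun y₂ => ?_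
  rw [LinearMap.zero_apply]
  by_contra hy
  -- The trivial relation between two values of `ψ`. As the kernel is a product, its first
  -- coordinate alone is in the kernel, so `ψ₂ y₂ * ψ₁ y₁ = 0` in a domain.
  have hmem : (ψ₂ y₂ • y₁, -(ψ₁ y₁ • y₂)) ∈ LinearMap.ker (ψ₁.coprod ψ₂) := by
    rw [LinearMap.mem_ker, LinearMap.coprod_apply, map_neg, map_smul, map_smul, smul_eq_mul,
      smul_eq_mul, mul_comm, add_neg_cancel]
  have hker := h.datum.ker_psi
  rw [hAB, syzSub, Submodule.prod_sup_prod] at hker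
  rw [hker] at hmem
  have hmem' : (ψ₂ y₂ • y₁, (0 : Kos 𝕜 n (n - 1))) ∈ LinearMap.ker (ψ₁.coprod ψ₂) := by
    rw [hker]
    exact ⟨hmem.1, Submodule.zero_mem _⟩
  rw [LinearMap.mem_ker, LinearMap.coprod_apply, map_zero, add_zero, map_smul,
    smul_eq_mul] at hmem'
  exact mul_ne_zero hy hx hmem'

theorem isWGraded_betaMap {β : Fin q → KK 𝕜 n t} (hβ : ∀ i, β i ∈ kkGr 𝕜 n t d (b i)) :
    IsWGraded b (fun _ => ((t + 1 : ℕ) : ℤ)) (LinearMap.fst _ _ _ ∘ₗ betaMap β) ∧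
      IsWGraded b (fun _ => ((n - 1 : ℕ) : ℤ) - d) (LinearMap.snd _ _ _ ∘ₗ betaMap β) := by
  constructor
  · refine isWGraded_of_single fun i => ?_
    rw [LinearMap.comp_apply, betaMap_single]
    exact (mem_kkGr.1 (hβ i)).1
  · refine isWGraded_of_single fun i => ?_
    rw [LinearMap.comp_apply, betaMap_single]
    exact (mem_kkGr.1 (hβ i)).2

/-- If `N` is the direct sum of submodules of the two summands, then `β` has a graded section
over `K_{n-1}(d)`. -/
theorem IsConstructionOf.exists_section (hn : t + 4 ≤ n) {β : Fin q → KK 𝕜 n t}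
    {ψ₁ : Kos 𝕜 n (t + 1) →ₗ[Poly 𝕜 n] Poly 𝕜 n} {ψ₂ : Kos 𝕜 n (n - 1) →ₗ[Poly 𝕜 n] Poly 𝕜 n}
    (h : IsConstructionOf t c d a b f g φ I β ψ₁ ψ₂) (hLB : IsLongBourbaki t c d a b f g φ I)
    {A : Submodule (Poly 𝕜 n) (Kos 𝕜 n (t + 1))} {B : Submodule (Poly 𝕜 n) (Kos 𝕜 n (n - 1))}
    (hAB : spanBeta β = A.prod B) :
    ∃ s : Kos 𝕜 n (n - 1) →ₗ[Poly 𝕜 n] (Fin q → Poly 𝕜 n),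
      IsWGraded (fun _ => ((n - 1 : ℕ) : ℤ) - d) b s ∧ ∀ k, betaMap β (s k) = (0, k) := by
  have hψ₂ := h.psi_snd_eq_zero hn hLB hAB
  obtain ⟨hβ1, hβ2⟩ := isWGraded_betaMap h.datum.beta_mem
  have hker := h.datum.ker_psi
  rw [hAB, syzSub, Submodule.prod_sup_prod] at hker
  have hex : ∀ J, ∃ y ∈ wGr 𝕜 n b (((n - 1 : ℕ) : ℤ) - d),
      betaMap β y = (0, Pi.single J 1) := by
    intro J
    have h1 : ((0 : Kos 𝕜 n (t + 1)), (Pi.single J 1 : Kos 𝕜 n (n - 1))) ∈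
        LinearMap.ker (ψ₁.coprod ψ₂) := by
      rw [LinearMap.mem_ker, LinearMap.coprod_apply, hψ₂, map_zero, LinearMap.zero_apply,
        add_zero]
    rw [hker] at h1
    obtain ⟨k, hk, w, hw, hkw⟩ := Submodule.mem_sup.1 h1.2
    have h2 : ((0 : Kos 𝕜 n (t + 1)), k) ∈ spanBeta β := by
      rw [hAB]; exact ⟨Submodule.zero_mem _, hk⟩
    rw [← range_betaMap] at h2
    obtain ⟨y, hy⟩ := h2
    -- Graded Nakayama: `e_J = k + w` with `k ∈ B` and `w ∈ E_n ⊆ 𝔪 K_{n-1}`, so in the degree of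
    -- the generators the component of `k` is exactly `e_J`.
    refine ⟨compW b (((n - 1 : ℕ) : ℤ) - d) y, compW_mem _ _ _, Prod.ext ?_ ?_⟩
    · have h3 := hβ1.map_compW (((n - 1 : ℕ) : ℤ) - d) y
      rw [LinearMap.comp_apply, LinearMap.comp_apply, hy] at h3
      exact h3.trans (map_zero _)
    · have h3 := hβ2.map_compW (((n - 1 : ℕ) : ℤ) - d) y
      rw [LinearMap.comp_apply, LinearMap.comp_apply, hy] at h3
      refine h3.trans ?_
      ext1 K
      have h4 : constantCoeff (k K) = constantCoeff ((Pi.single J 1 : Kos 𝕜 n (n - 1)) K) := by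
        rw [← show k + w = Pi.single J 1 from hkw]
        change constantCoeff (k K) = constantCoeff (k K + w K)
        rw [map_add, constantCoeff_of_mem_syz hw, add_zero]
      rw [compW_apply, sub_self, polyComp_zero]
      change C (constantCoeff (k K)) = (Pi.single J 1 : Kos 𝕜 n (n - 1)) K
      rw [h4, Pi.single_apply]
      split_ifs <;> simp
  choose y hy hyβ using hex
  refine ⟨Fintype.linearCombination (Poly 𝕜 n) y, ?_, ?_⟩
  · refine isWGraded_of_single fun J => ?_
    simpa using hy J
  · have h1 : betaMap β ∘ₗ Fintype.linearCombination (Poly 𝕜 n) y = LinearMap.inr _ _ _ := by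
      refine LinearMap.pi_ext' fun J => LinearMap.ext_ring ?_
      simp [hyβ]
    exact LinearMap.congr_fun h1

/-- Vanishing of `ψ₂` makes `φ` factor through `E_{t+1}`. Splitting `K_{n-1}(d)` off `G` along the
section, and `K_n(d)` off `F`, makes `f` and `g` block diagonal; the complementary blocks inherit
exactness. -/
theorem IsConstructionOf.isTrivialType (hn : t + 4 ≤ n) {β : Fin q → KK 𝕜 n t}
    {ψ₁ : Kos 𝕜 n (t + 1) →ₗ[Poly 𝕜 n] Poly 𝕜 n} {ψ₂ : Kos 𝕜 n (n - 1) →ₗ[Poly 𝕜 n] Poly 𝕜 n}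
    (h : IsConstructionOf t c d a b f g φ I β ψ₁ ψ₂) (hLB : IsLongBourbaki t c d a b f g φ I)
    {A : Submodule (Poly 𝕜 n) (Kos 𝕜 n (t + 1))} {B : Submodule (Poly 𝕜 n) (Kos 𝕜 n (n - 1))}
    (hAB : spanBeta β = A.prod B) : IsTrivialType t c d a b f g φ I := by
  have hψ₂ := h.psi_snd_eq_zero hn hLB hAB
  obtain ⟨s, hs, hβs⟩ := h.exists_section hn hLB hAB
  obtain ⟨-, hβ2⟩ := isWGraded_betaMap h.datum.beta_mem
  have hg' : ∀ y, dBar 𝕜 n t (betaMap β y) = g y := LinearMap.congr_fun h.lifts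
  obtain ⟨q', b', v, hv, hvs, hvπ, hv0⟩ :=
    exists_graded_splitting hβ2 hs (fun k => by rw [LinearMap.comp_apply, hβs]; rfl)
  have hfg := hLB.exact_g
  have hgφ := hLB.exact_phi
  have hgraded_f : IsWGraded a b f := by
    have := hLB.graded_f
    rwa [isGradedHom_zero_iff, freeGr_eq, freeGr_eq] at this
  let g' : (Fin q' → Poly 𝕜 n) →ₗ[Poly 𝕜 n] Syz 𝕜 n (t + 1) :=
    LinearMap.fst _ _ _ ∘ₗ g ∘ₗ v.symm.toLinearMap ∘ₗ LinearMap.inl _ _ _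
  let φ' : Syz 𝕜 n (t + 1) →ₗ[Poly 𝕜 n] Poly 𝕜 n := φ ∘ₗ LinearMap.inl _ _ _
  have hgs : ∀ k, g (s k) = (0, toSyz 𝕜 n (n - 1) k) := by
    intro k
    rw [← hg', hβs, dBar_apply, map_zero]
  have hgj : ∀ z, g (v.symm (z, 0)) = (g' z, 0) := by
    intro z
    refine Prod.ext rfl ?_
    rw [← hg', dBar_apply]
    have h1 := hvπ (v.symm (z, 0))
    rw [LinearEquiv.apply_symm_apply] at h1
    exact (congrArg (toSyz 𝕜 n (n - 1)) h1.symm).trans (map_zero _)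
  have hsplit : ∀ z k, v.symm (z, k) = v.symm (z, 0) + s k := by
    intro z k
    rw [LinearEquiv.symm_apply_eq, map_add, LinearEquiv.apply_symm_apply, hv0, Prod.mk_add_mk,
      add_zero, zero_add]
  have hgv : ∀ y, g y = (g' (v y).1, toSyz 𝕜 n (n - 1) (v y).2) := by
    intro y
    obtain ⟨⟨z, k⟩, rfl⟩ := v.symm.surjective y
    rw [LinearEquiv.apply_symm_apply, hsplit, map_add, hgj, hgs, Prod.mk_add_mk, add_zero,
      zero_add]
  have hφ0 : ∀ x : EE 𝕜 n t, φ x = φ' x.1 := by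
    rintro ⟨x, y⟩
    obtain ⟨k, rfl⟩ := toSyz_surjective _ y
    have h1 : φ (0, toSyz 𝕜 n (n - 1) k) = 0 := by
      have h2 := LinearMap.congr_fun h.comp_phi (0, k)
      rw [LinearMap.comp_apply, dBar_apply, LinearMap.coprod_apply, hψ₂, map_zero, map_zero,
        LinearMap.zero_apply, add_zero] at h2
      exact h2
    have h2 : (x, toSyz 𝕜 n (n - 1) k) = (x, 0) + (0, toSyz 𝕜 n (n - 1) k) := by
      rw [Prod.mk_add_mk, add_zero, zero_add]
    exact (congrArg φ h2).trans (by rw [map_add, h1, add_zero]; rfl)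
  -- As `g ∘ f = 0`, the `K_{n-1}`-component of `f` lies in `Ker ∂_{n-1} = Im ∂_n`, and so defines a
  -- projection of `F` onto `K_n`.
  obtain ⟨π, hπ⟩ := exists_factor_of_injective
    (LinearMap.snd _ _ _ ∘ₗ v.toLinearMap ∘ₗ f) (kosD 𝕜 n n) (kosD_card_injective (by omega)) (by
      rintro _ ⟨x, rfl⟩
      have h1 := hgv (f x)
      rw [(hfg _).2 ⟨x, rfl⟩] at h1
      have h2 := toSyz_eq_zero.1 (congrArg Prod.snd h1).symm
      exact (mem_syz_iff (by omega)).2 h2)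
  have hπ' : ∀ x, kosD 𝕜 n n (π x) = (v (f x)).2 := LinearMap.congr_fun hπ
  -- The section of `π`: `g` kills `s ∘ ∂_n`, which therefore factors through `f`.
  obtain ⟨σ, hσ⟩ := exists_factor_of_injective (s ∘ₗ kosD 𝕜 n n) f hLB.injective (by
      rintro _ ⟨k, rfl⟩
      refine (hfg _).1 ?_
      rw [LinearMap.comp_apply, hgs, toSyz_eq_zero.2 (kosD_kosD (by omega) k)]
      rfl)
  have hσ' : ∀ k, f (σ k) = s (kosD 𝕜 n n k) := LinearMap.congr_fun hσ
  have hD : ((n - 1 : ℕ) : ℤ) - d = (n : ℤ) - d - 1 := by omega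
  have hkosD : IsWGraded (𝕜 := 𝕜) (fun _ => (n : ℤ) - d) (fun _ => ((n - 1 : ℕ) : ℤ) - d)
      (kosD 𝕜 n n) := by
    rw [hD]; exact isWGraded_kosD n _
  have hπg : IsWGraded a (fun _ => (n : ℤ) - d) π := by
    intro e x hx
    refine hkosD.mem_of_injective (kosD_card_injective (by omega)) ?_
    rw [hπ', hvπ]
    exact hβ2 _ _ (hgraded_f _ _ hx)
  have hσg : IsWGraded (fun _ => (n : ℤ) - d) a σ := by
    intro e k hk
    refine hgraded_f.mem_of_injective hLB.injective ?_
    rw [hσ']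
    exact hs _ _ (hkosD _ _ hk)
  obtain ⟨p', a', u, hu, hus, huπ, hu0⟩ := exists_graded_splitting hπg hσg (fun k => by
    apply kosD_card_injective (𝕜 := 𝕜) (n := n) (by omega)
    rw [hπ', hσ', hv0])
  let f' : (Fin p' → Poly 𝕜 n) →ₗ[Poly 𝕜 n] (Fin q' → Poly 𝕜 n) :=
    (LinearMap.fst _ _ _ ∘ₗ v.toLinearMap) ∘ₗ f ∘ₗ u.symm.toLinearMap ∘ₗ LinearMap.inl _ _ _
  have hvfj : ∀ z, v (f (u.symm (z, 0))) = (f' z, 0) := by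
    intro z
    refine Prod.ext rfl ?_
    rw [← hπ', ← huπ, LinearEquiv.apply_symm_apply, map_zero]
  have husplit : ∀ z k, u.symm (z, k) = u.symm (z, 0) + σ k := by
    intro z k
    rw [LinearEquiv.symm_apply_eq, map_add, LinearEquiv.apply_symm_apply, hu0, Prod.mk_add_mk,
      add_zero, zero_add]
  have hvf : ∀ x, v (f x) = (f' (u x).1, kosD 𝕜 n n (u x).2) := by
    intro x
    obtain ⟨⟨z, k⟩, rfl⟩ := u.symm.surjective x
    rw [LinearEquiv.apply_symm_apply, husplit, map_add, map_add, hvfj, hσ', hv0, Prod.mk_add_mk,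
      add_zero, zero_add]
  refine ⟨p', q', a', b', f', g', φ', u, v, ?_, ?_, ?_, ?_, ?_, ?_, ?_, ?_, ?_, ?_, ?_, ?_⟩
  · rw [isGradedHom_zero_iff, freeGr_eq, freeGr_eq]
    exact hv.comp (hgraded_f.comp hus)
  · rw [isGradedHom_zero_iff, freeGr_eq]
    intro e z hz
    have h1 := hLB.graded_g
    rw [isGradedHom_zero_iff, freeGr_eq] at h1
    exact (h1 _ _ (hvs _ _ hz)).1
  · rw [isGradedHom_zero_iff]
    intro e x hx
    exact isGradedHom_zero_iff.1 hLB.graded_phi e (x, 0) ⟨hx, Submodule.zero_mem _⟩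
  · rw [← LinearMap.ker_eq_bot, LinearMap.ker_eq_bot']
    intro z hz
    have h1 := hvfj z
    rw [hz] at h1
    have h2 : f (u.symm (z, 0)) = f 0 := by
      rw [map_zero]; exact v.map_eq_zero_iff.1 h1
    have h3 := u.symm.map_eq_zero_iff.1 (hLB.injective h2)
    exact congrArg Prod.fst h3
  · intro y
    constructor
    · intro hy
      have h1 := hgj y
      rw [hy] at h1
      obtain ⟨x, hx⟩ := (hfg _).1 h1
      have h2 := hvf x
      rw [hx, LinearEquiv.apply_symm_apply] at h2
      exact ⟨_, (congrArg Prod.fst h2).symm⟩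
    · rintro ⟨z, rfl⟩
      have h1 := hgv (f (u.symm (z, 0)))
      rw [(hfg _).2 ⟨_, rfl⟩, hvfj] at h1
      exact (congrArg Prod.fst h1).symm
  · intro x
    constructor
    · intro hx
      obtain ⟨y, hy⟩ := (hgφ (x, 0)).1 hx
      rw [hgv] at hy
      exact ⟨_, congrArg Prod.fst hy⟩
    · rintro ⟨y, rfl⟩
      have h1 : φ (g (v.symm (y, 0))) = 0 := (hgφ _).2 ⟨_, rfl⟩
      rw [hgj] at h1
      exact h1
  · rw [← hLB.range_phi]
    ext r
    constructor
    · rintro ⟨x, rfl⟩; exact ⟨_, rfl⟩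
    · rintro ⟨x, rfl⟩; exact ⟨x.1, (hφ0 x).symm⟩
  · rw [isGradedHom_zero_iff, freeGr_eq, freeGr_eq, shift_kosGr_eq]
    intro e x hx
    refine ⟨hu _ _ hx, ?_⟩
    change (u x).2 ∈ _
    rw [huπ]
    exact hπg _ _ hx
  · rw [isGradedHom_zero_iff, freeGr_eq, freeGr_eq, shift_kosGr_eq]
    intro e y hy
    refine ⟨hv _ _ hy, ?_⟩
    change (v y).2 ∈ _
    rw [hvπ]
    exact hβ2 _ _ hy
  · exact LinearMap.ext hvf
  · exact LinearMap.ext hgv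
  · exact LinearMap.ext hφ0

end TrivialType

end LongBourbaki

/-! ### The two equivalences -/

theorem theorem2p6 {𝕜 : Type*} [Field 𝕜] {n t p q : ℕ} (hn : 4 ≤ n) (ht : t ≤ n - 4)
    (c d : ℤ) (a : Fin p → ℤ) (b : Fin q → ℤ)
    (f : (Fin p → LongBourbaki.Poly 𝕜 n) →ₗ[LongBourbaki.Poly 𝕜 n]
      (Fin q → LongBourbaki.Poly 𝕜 n))
    (g : (Fin q → LongBourbaki.Poly 𝕜 n) →ₗ[LongBourbaki.Poly 𝕜 n] LongBourbaki.EE 𝕜 n t)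
    (φ : LongBourbaki.EE 𝕜 n t →ₗ[LongBourbaki.Poly 𝕜 n] LongBourbaki.Poly 𝕜 n)
    (I : Ideal (LongBourbaki.Poly 𝕜 n))
    (hf : LongBourbaki.IsGradedHom 0 (LongBourbaki.freeGr 𝕜 n a) (LongBourbaki.freeGr 𝕜 n b) f)
    (hg : LongBourbaki.IsGradedHom 0 (LongBourbaki.freeGr 𝕜 n b) (LongBourbaki.eeGr 𝕜 n t d) g)
    (hφ : LongBourbaki.IsGradedHom 0 (LongBourbaki.eeGr 𝕜 n t d)
      (LongBourbaki.shift (LongBourbaki.polyGr 𝕜 n) c) φ)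
    (hg0 : ∀ i, g (Pi.single i 1) ≠ 0) :
    -- the equivalence with nonzero summands, the case `t = 0`, `I = h • 𝔪` being excluded
    ((1 ≤ t ∨ ∀ h : LongBourbaki.Poly 𝕜 n,
        I ≠ Ideal.span {h} * Ideal.span (Set.range MvPolynomial.X)) →
      (LongBourbaki.IsNontrivialType t c d a b f g φ I ↔
        (∃ β ψ₁ ψ₂, LongBourbaki.IsConstructionOf t c d a b f g φ I β ψ₁ ψ₂) ∧
        ∀ β ψ₁ ψ₂, LongBourbaki.IsConstructionOf t c d a b f g φ I β ψ₁ ψ₂ →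
          ¬ ∃ (A : Submodule (LongBourbaki.Poly 𝕜 n) (LongBourbaki.Kos 𝕜 n (t + 1)))
              (B : Submodule (LongBourbaki.Poly 𝕜 n) (LongBourbaki.Kos 𝕜 n (n - 1))),
              A ≠ ⊥ ∧ B ≠ ⊥ ∧ LongBourbaki.spanBeta β = A.prod B)) ∧
    -- the equivalence in all cases, with summands that may vanish
    (LongBourbaki.IsNontrivialType t c d a b f g φ I ↔
      (∃ β ψ₁ ψ₂, LongBourbaki.IsConstructionOf t c d a b f g φ I β ψ₁ ψ₂) ∧
      ∀ β ψ₁ ψ₂, LongBourbaki.IsConstructionOf t c d a b f g φ I β ψ₁ ψ₂ →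
        ¬ ∃ (A : Submodule (LongBourbaki.Poly 𝕜 n) (LongBourbaki.Kos 𝕜 n (t + 1)))
            (B : Submodule (LongBourbaki.Poly 𝕜 n) (LongBourbaki.Kos 𝕜 n (n - 1))),
            LongBourbaki.spanBeta β = A.prod B) := by
  have hn' : t + 4 ≤ n := by omega
  have hforward : LongBourbaki.IsNontrivialType t c d a b f g φ I →
      ∃ β ψ₁ ψ₂, LongBourbaki.IsConstructionOf t c d a b f g φ I β ψ₁ ψ₂ := by
    intro h
    obtain ⟨β, hβ, hβg⟩ := LongBourbaki.exists_lift_dBar (by omega) hg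
    exact ⟨_, _, _, h.1.isConstructionOf hn' hg0 hβ hβg⟩
  have htop : (⊤ : Submodule (LongBourbaki.Poly 𝕜 n) (LongBourbaki.Kos 𝕜 n (n - 1))) ≠ ⊥ := by
    obtain ⟨J, -⟩ := LongBourbaki.kosD_ne_zero (𝕜 := 𝕜) (n := n) (k := n - 1) (by omega) (by omega)
    have : Nonempty {J : Finset (Fin n) // J.card = n - 1} := ⟨J⟩
    exact top_ne_bot
  refine ⟨fun hass => ⟨fun h => ⟨hforward h, ?_⟩, ?_⟩, ⟨fun h => ⟨hforward h, ?_⟩, ?_⟩⟩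
  · rintro β ψ₁ ψ₂ hc ⟨A, B, -, -, hAB⟩
    exact h.2 (hc.isTrivialType hn' h.1 hAB)
  · rintro ⟨⟨β, ψ₁, ψ₂, hc⟩, hall⟩
    have hLB := hc.isLongBourbaki (by omega) hg hφ
    refine ⟨hLB, fun hT => ?_⟩
    -- The decomposition is found for a choice adapted to the splitting, not for the given one;
    -- hence indecomposability is required for every admissible choice.
    obtain ⟨β', ψ₁', ψ₂', hc', A, hA, hA0⟩ := hT.exists_decomposition hn' hLB hg0
    exact hall β' ψ₁' ψ₂' hc' ⟨A, ⊤, hA0 hass, htop, hA⟩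
  · rintro β ψ₁ ψ₂ hc ⟨A, B, hAB⟩
    exact h.2 (hc.isTrivialType hn' h.1 hAB)
  · rintro ⟨⟨β, ψ₁, ψ₂, hc⟩, hall⟩
    have hLB := hc.isLongBourbaki (by omega) hg hφ
    refine ⟨hLB, fun hT => ?_⟩
    obtain ⟨β', ψ₁', ψ₂', hc', A, hA, -⟩ := hT.exists_decomposition hn' hLB hg0
    exact hall β' ψ₁' ψ₂' hc' ⟨A, ⊤, hA⟩
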